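/- **Theorem 2.** Let $d\ge 1$, $\gamma>1$, $p\ge 0$, $T>0$. For a conservative state $\mathbf u=(\rho,\rho\mathbf V,\rho E)\in\mathbb R^{d+2}$ with $\rho>0$ and pressure $P=(\gamma-1)(\rho E-\tfrac12\rho|\mathbf V|^2)>0$ put $\beta=\rho/P$, $s=\log(P/\rho^\gamma)$, and let $H(\mathbf u)=-\rho s/(\gamma-1)$ be the generalized entropy, $\boldsymbol v(\mathbf u)=\partial H/\partial\mathbf u=\big(\tfrac{\gamma-s}{\gamma-1}-\tfrac{\beta}{2}|\mathbf V|^2,\ \beta\mathbf V,\ -\beta\big)$ the entropy variables, $\mathbf u(\boldsymbol v)$ the inverse map (defined where the last component of $\boldsymbol v$ is negative), $\mathbf F=(\rho\mathbf V,\ \rho\mathbf V\otimes\mathbf V+P\mathbf I,\ (\rho E+P)\mathbf V)$ the Euler flux and $\Psi_{\boldsymbol n}=\rho\mathbf V\cdot\boldsymbol n$ the entropy potential. For an interior state $\boldsymbol v$ and a trace state $\widehat{\boldsymbol v}$ write $[\![a]\!]=\widehat a-a$, $\overline a=(a+\widehat a)/2$, $a^{\ln}=[\![a]\!]/\ln(\widehat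 a/a)$ (and $a^{\ln}=a$ if $\widehat a=a$), $\overline p=\overline\rho/\overline\beta$, and let $\overline{\mathbf F}(\widehat{\boldsymbol v},\boldsymbol v;\boldsymbol n)=(f_1,\mathbf f_2,f_3)$ with $$f_1=\rho^{\ln}\,\overline{\mathbf V}\cdot\boldsymbol n,\qquad \mathbf f_2=\overline{\mathbf V}f_1+\overline p\,\boldsymbol n,\qquad f_3=\Big(\frac1{\beta^{\ln}(\gamma-1)}-\frac{\overline{\mathbf V\cdot\mathbf V}}2\Big)f_1+\overline{\mathbf V}\cdot\mathbf f_2 .$$ Let $\mathcal T_h$ be a finite mesh of the periodic domain $\mathbb R^d/\Lambda$ ($\Lambda$ a full-rank lattice) by macro-elements $K$: simplices whose $\Lambda$-translates cover $\mathbb R^d$ with pairwise disjoint interiors, each subdivided into finitely many simplicial finite elements. Faces are the intersections $\partial K^+\cap\partial K^-$ of the boundaries of two different (translates of) macro-elements that have nonzero $(d-1)$-dimensional measure. Let $\boldsymbol{\mathcal V}_h$ be the space of $\mathbb R^{d+2}$-valued functions that are continuous on each macro-element (not across macro-elements) and polynomial of degree at most $p$ on each finite element, and $\boldsymbol{\mathcal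 M}_h$ the space of single-valued, $\Lambda$-periodic $\mathbb R^{d+2}$-valued functions on the union of the faces that are polynomial of degree at most $p$ on each face. Let $\boldsymbol v_h(t)\in\boldsymbol{\mathcal V}_h$, differentiable in time, and $\widehat{\boldsymbol v}_h(t)\in\boldsymbol{\mathcal M}_h$, $t\in[0,T]$, be physically admissible (last component negative on each closed macro-element, respectively on each closed face) and solve the macro-element entropy-variable HDG discretization of the compressible Euler equations with numerical flux $\widehat{\mathbf F}_h=\overline{\mathbf F}(\widehat{\boldsymbol v}_h,\boldsymbol v_h;\boldsymbol n)$, $\boldsymbol n$ the outward unit normal of each macro-element: for all $t\in[0,T]$, $\boldsymbol w\in\boldsymbol{\mathcal V}_h$, $\boldsymbol\mu\in\boldsymbol{\mathcal M}_h$, $$\sum_K\int_K\partial_t\mathbf u(\boldsymbol v_h)\cdot\boldsymbol w-\sum_K\int_K\mathbf F(\mathbf u(\boldsymbol v_h)):\nabla\boldsymbol w+\sum_K\int_{\partial K}\widehat{\mathbf F}_h\cdot\boldsymbol w=0,\qquad \sum_K\int_{\partial K}\widehat{\mathbf F}_h\cdot\boldsymbol\mu=0 .$$ Then the discretization is entropy-conservative: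 the flux satisfies $[\![\boldsymbol v]\!]^T\overline{\mathbf F}(\widehat{\boldsymbol v},\boldsymbol v;\boldsymbol n)-[\![\Psi_{\boldsymbol n}]\!]=0$ for all admissible states $\widehat{\boldsymbol v},\boldsymbol v$ and all $\boldsymbol n\in\mathbb R^d$, and the total generalized entropy is constant in time: $H(\mathbf u(\boldsymbol v_h(t)))$ is integrable on each macro-element, $$\frac{\mathrm d}{\mathrm dt}\sum_K\int_K H(\mathbf u(\boldsymbol v_h))=0\quad\text{for all }t\in[0,T],\qquad\text{and}\qquad \sum_K\int_K H(\mathbf u(\boldsymbol v_h(t)))=\sum_K\int_K H(\mathbf u(\boldsymbol v_h(0))).$$ -/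

import Mathlib

open MeasureTheory Set
open scoped Matrix

noncomputable section

namespace EntropyHDG

/-- Physical space `ℝ^d` with its Euclidean norm. -/
abbrev Space (d : ℕ) : Type := EuclideanSpace ℝ (Fin d)

/-- State vectors in `ℝ^(d+2)`: one mass component (index `0`), `d` momentum components and one
energy component (the last index). Used for conservative variables `u`, for entropy variables `v`
and for fluxes through a face. -/
abbrev State (d : ℕ) : Type := Fin (d + 2) → ℝ

variable {d : ℕ}

/-- The index of the `i`-th momentum component. -/
def momIdx (i : Fin d) : Fin (d + 2) := i.castSucc.succ

/-- The index of the energy component. -/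
def enIdx (d : ℕ) : Fin (d + 2) := Fin.last (d + 1)

/-- The state vector `(a, m, b)`. -/
def mkState (a : ℝ) (m : Fin d → ℝ) (b : ℝ) : State d :=
  Fin.cons (α := fun _ => ℝ) a (Fin.snoc (α := fun _ => ℝ) m b)

@[simp] theorem mkState_zero (a : ℝ) (m : Fin d → ℝ) (b : ℝ) : mkState a m b 0 = a := rfl

@[simp] theorem mkState_mom (a : ℝ) (m : Fin d → ℝ) (b : ℝ) (i : Fin d) :
    mkState a m b (momIdx i) = m i := by
  simp [mkState, momIdx]

@[simp] theorem mkState_en (a : ℝ) (m : Fin d → ℝ) (b : ℝ) :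
    mkState a m b (enIdx d) = b := by
  rw [mkState, enIdx, ← Fin.succ_last, Fin.cons_succ, Fin.snoc_last]

/-- Two states with the same mass, momentum and energy components are equal. -/
theorem state_ext {a b : State d} (h0 : a 0 = b 0) (hm : ∀ i, a (momIdx i) = b (momIdx i))
    (he : a (enIdx d) = b (enIdx d)) : a = b := by
  funext k
  refine Fin.cases h0 (fun j => ?_) k
  refine Fin.lastCases ?_ (fun i => ?_) j
  · rw [Fin.succ_last]; exact he
  · exact hm i

/-! ### The compressible Euler equations

Conservative variables `u = (ρ, ρV, ρE)`, ideal gas with `P = (γ - 1) (ρE - ρ |V|² / 2)`. -/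

def density (u : State d) : ℝ := u 0

def velocity (u : State d) : Fin d → ℝ := fun i => u (momIdx i) / density u

def pressure (γ : ℝ) (u : State d) : ℝ :=
  (γ - 1) * (u (enIdx d) - density u * (velocity u ⬝ᵥ velocity u) / 2)

/-- `β = ρ / P`. -/
def beta (γ : ℝ) (u : State d) : ℝ := density u / pressure γ u

/-- The specific entropy `s = log (P / ρ ^ γ)`. -/
def specificEntropy (γ : ℝ) (u : State d) : ℝ := Real.log (pressure γ u / density u ^ γ)

/-- The generalized entropy `H = - ρ s / (γ - 1)`. -/
def entropy (γ : ℝ) (u : State d) : ℝ := -(density u * specificEntropy γ u) / (γ - 1)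

/-- The entropy variables `v(u) = ∂H/∂u`. -/
def entropyVars (γ : ℝ) (u : State d) : State d :=
  mkState ((γ - specificEntropy γ u) / (γ - 1) - beta γ u * (velocity u ⬝ᵥ velocity u) / 2)
    (beta γ u • velocity u) (-beta γ u)

/-- Physically admissible conservative states: positive density and pressure. -/
def Physical (γ : ℝ) (u : State d) : Prop := 0 < density u ∧ 0 < pressure γ u

/-- Admissible entropy states: `-β < 0`. These are exactly the entropy variables of physical
states (see the theorems at the end). -/
def Admissible (v : State d) : Prop := v (enIdx d) < 0

/-- The conservative variables `u(v)` as a function of the entropy variables: the inverse of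
`entropyVars` between admissible entropy states and physical states. -/
def consVars (γ : ℝ) (v : State d) : State d :=
  let β : ℝ := -v (enIdx d)
  let V : Fin d → ℝ := fun i => v (momIdx i) / β
  let s : ℝ := γ - (γ - 1) * (v 0 + β * (V ⬝ᵥ V) / 2)
  let ρ : ℝ := Real.exp (-(s + Real.log β) / (γ - 1))
  mkState ρ (ρ • V) (ρ / β / (γ - 1) + ρ * (V ⬝ᵥ V) / 2)

/-- The inviscid flux; entry `(k, j)` is the flux of the `k`-th component in direction `j`:
`F = (ρ V, ρ V ⊗ V + P I, ρ V (E + P / ρ))`. -/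
def eulerFlux (γ : ℝ) (u : State d) (k : Fin (d + 2)) (j : Fin d) : ℝ :=
  mkState (density u * velocity u j)
    (fun i => density u * velocity u i * velocity u j + if i = j then pressure γ u else 0)
    ((u (enIdx d) + pressure γ u) * velocity u j) k

/-- The entropy potential in direction `n`: `Ψ_n = ρ V · n`. -/
def entropyPotential (u : State d) (n : Fin d → ℝ) : ℝ := density u * (velocity u ⬝ᵥ n)

/-! ### The entropy-conservative numerical flux -/

/-- Arithmetic mean. -/
def mean (a b : ℝ) : ℝ := (a + b) / 2

/-- Logarithmic mean, continuously extended to `a = b`. -/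
def logMean (a b : ℝ) : ℝ := if a = b then a else (b - a) / Real.log (b / a)

/-- The entropy-conservative flux through a face with unit normal `n`, as a function of the
conservative states `uh` (trace) and `u` (interior). -/
def ecFluxCons (γ : ℝ) (uh u : State d) (n : Fin d → ℝ) : State d :=
  let Vbar : Fin d → ℝ := fun i => mean (velocity u i) (velocity uh i)
  let pbar : ℝ := mean (density u) (density uh) / mean (beta γ u) (beta γ uh)
  let VVbar : ℝ := mean (velocity u ⬝ᵥ velocity u) (velocity uh ⬝ᵥ velocity uh)
  let f₁ : ℝ := logMean (density u) (density uh) * (Vbar ⬝ᵥ n)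
  let f₂ : Fin d → ℝ := f₁ • Vbar + pbar • n
  let f₃ : ℝ := (1 / (logMean (beta γ u) (beta γ uh) * (γ - 1)) - VVbar / 2) * f₁ + Vbar ⬝ᵥ f₂
  mkState f₁ f₂ f₃

/-- The entropy-conservative flux as a function of the entropy states `vh` (trace) and `v`
(interior). -/
def ecFlux (γ : ℝ) (vh v : State d) (n : Fin d → ℝ) : State d :=
  ecFluxCons γ (consVars γ vh) (consVars γ v) n

/-! ### Macro-element meshes of a periodic domain -/

/-- A simplicial macro-element mesh of the periodic domain `ℝ^d / Λ`, where `Λ` is the lattice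
spanned by `period`. The macro-elements are represented by simplices in `ℝ^d` whose `Λ`-translates
tile `ℝ^d`; every macro-element is subdivided into finitely many simplicial finite elements. No
matching condition is imposed on neighbouring simplices, so conforming meshes are a special
case. -/
structure MacroMesh (d : ℕ) where
  /-- a basis of the lattice of periods -/
  period : Module.Basis (Fin d) ℝ (Space d)
  /-- the number of macro-elements -/
  N : ℕ
  /-- the macro-elements -/
  elem : Fin N → Affine.Simplex ℝ (Space d) d
  /-- the number of finite elements inside a macro-element -/
  numSub : Fin N → ℕ
  /-- the finite elements inside a macro-element -/
  sub : (i : Fin N) → Fin (numSub i) → Affine.Simplex ℝ (Space d) d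
  /-- the translates of the macro-elements cover space -/
  cover : ∀ x : Space d, ∃ (i : Fin N) (m : Fin d → ℤ),
    x - ∑ k, (m k : ℝ) • period k ∈ (elem i).closedInterior
  /-- two different translates of macro-elements have disjoint interiors -/
  disjoint : ∀ (i j : Fin N) (m : Fin d → ℤ), (j, m) ≠ (i, 0) →
    Disjoint (interior (elem i).closedInterior)
      (interior ((fun x => x + ∑ k, (m k : ℝ) • period k) '' (elem j).closedInterior))
  /-- the finite elements of a macro-element cover it -/
  sub_cover : ∀ i : Fin N, ⋃ a, (sub i a).closedInterior = (elem i).closedInterior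
  /-- the finite elements of a macro-element have disjoint interiors -/
  sub_disjoint : ∀ (i : Fin N) (a b : Fin (numSub i)), a ≠ b →
    Disjoint (interior (sub i a).closedInterior) (interior (sub i b).closedInterior)

namespace MacroMesh

variable (M : MacroMesh d)

/-- The lattice vector with integer coordinates `m`. -/
def shift (m : Fin d → ℤ) : Space d := ∑ k, (m k : ℝ) • M.period k

/-- The closed macro-element `K_i`. -/
def cell (i : Fin M.N) : Set (Space d) := (M.elem i).closedInterior

/-- The intersection `∂K_i ∩ ∂(K_j + λ_m)`, where `λ_m` is the lattice vector with coordinates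
`m`. -/
def interface (i j : Fin M.N) (m : Fin d → ℤ) : Set (Space d) :=
  frontier (M.cell i) ∩ frontier ((fun x => x + M.shift m) '' M.cell j)

/-- `interface i j m` is a face of the mesh: it is shared by two different translates of
macro-elements and has nonzero `(d-1)`-dimensional measure. -/
def IsFace (i j : Fin M.N) (m : Fin d → ℤ) : Prop :=
  (j, m) ≠ (i, 0) ∧ Measure.euclideanHausdorffMeasure (d - 1) (M.interface i j m) ≠ 0

end MacroMesh

/-- `f` is given by a polynomial of degree at most `p` in every component, at the point `x`. -/
def EvalsTo (q : Fin (d + 2) → MvPolynomial (Fin d) ℝ) (f : Space d → State d)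
    (x : Space d) : Prop :=
  ∀ k, f x k = MvPolynomial.eval (fun i => x i) (q k)

/-- The space `V_h`: on each macro-element a continuous function that is a polynomial of degree at
most `p` on each of its finite elements. No continuity between macro-elements. -/
def InV (M : MacroMesh d) (p : ℕ) (w : Fin M.N → Space d → State d) : Prop :=
  ∀ i, ContinuousOn (w i) (M.cell i) ∧
    ∀ a, ∃ q : Fin (d + 2) → MvPolynomial (Fin d) ℝ, (∀ k, (q k).totalDegree ≤ p) ∧
      ∀ x ∈ (M.sub i a).closedInterior, EvalsTo q (w i) x

/-- The trace space `M_h`: single-valued, periodic functions on the skeleton of the mesh that agree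
almost everywhere on each face with a polynomial of degree at most `p`. Values off the skeleton
play no role. -/
def InTrace (M : MacroMesh d) (p : ℕ) (μ : Space d → State d) : Prop :=
  (∀ x m, μ (x + M.shift m) = μ x) ∧
    ∀ i j m, M.IsFace i j m →
      ∃ q : Fin (d + 2) → MvPolynomial (Fin d) ℝ, (∀ k, (q k).totalDegree ≤ p) ∧
        ∀ᵐ x ∂(Measure.euclideanHausdorffMeasure (d - 1)).restrict (M.interface i j m),
          EvalsTo q μ x

/-- A trace is admissible if on each face its energy component is essentially bounded by a negative
number. For a function in the trace space this says that its polynomial on each (closed) face takes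
admissible values. -/
def AdmissibleTrace (M : MacroMesh d) (μ : Space d → State d) : Prop :=
  ∀ i j m, M.IsFace i j m → ∃ δ > 0,
    ∀ᵐ x ∂(Measure.euclideanHausdorffMeasure (d - 1)).restrict (M.interface i j m),
      μ x (enIdx d) ≤ -δ

/-! ### Integrals over element boundaries -/

section Boundary

variable [NeZero d]

/-- The outward unit normal of a simplex on its face opposite to the `k`-th vertex: the unit vector
from that vertex to the foot of its altitude. -/
def outwardNormal (K : Affine.Simplex ℝ (Space d) d) (k : Fin (d + 1)) : Space d :=
  (K.height k)⁻¹ • (K.altitudeFoot k - K.points k)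

/-- `∫_{∂K} g(x, n(x))`, where `n` is the outward unit normal of the simplex `K`, with respect to
the `(d-1)`-dimensional surface measure: the sum of the integrals over the faces of `K`. -/
def boundaryIntegral (K : Affine.Simplex ℝ (Space d) d)
    (g : Space d → (Fin d → ℝ) → ℝ) : ℝ :=
  ∑ k, ∫ x in (K.faceOpposite k).closedInterior, g x (fun i => outwardNormal K k i)
    ∂(Measure.euclideanHausdorffMeasure (d - 1))

/-! ### The semi-discrete scheme -/

/-- Solutions on `[0, T]` of the macro-element entropy-variable HDG discretization of degree `p` of
the compressible Euler equations on the periodic domain, with inviscid numerical flux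
`Fhat vh v n`. The unknowns are `v t i x`, the value at time `t` and point `x` of the `i`-th
macro-element, and the trace `vh t x`. -/
structure IsHDGSolution (M : MacroMesh d) (γ : ℝ) (p : ℕ) (T : ℝ)
    (Fhat : State d → State d → (Fin d → ℝ) → State d)
    (v : ℝ → Fin M.N → Space d → State d) (vh : ℝ → Space d → State d) : Prop where
  mem_V : ∀ t ∈ Icc 0 T, InV M p (v t)
  mem_trace : ∀ t ∈ Icc 0 T, InTrace M p (vh t)
  admissible : ∀ t ∈ Icc 0 T, ∀ i, ∀ x ∈ M.cell i, Admissible (v t i x)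
  admissible_trace : ∀ t ∈ Icc 0 T, AdmissibleTrace M (vh t)
  differentiable : ∀ i, ∀ x ∈ M.cell i, DifferentiableOn ℝ (fun t => v t i x) (Icc 0 T)
  /-- `(∂u(v_h)/∂t, w) - (F(v_h), ∇w) + ⟨Fhat, w⟩_{∂T_h} = 0` for all `w ∈ V_h` -/
  cell_eq : ∀ t ∈ Icc 0 T, ∀ w, InV M p w →
    (∑ i, ∫ x in M.cell i,
        derivWithin (fun τ => consVars γ (v τ i x)) (Icc 0 T) t ⬝ᵥ w i x)
      - (∑ i, ∫ x in M.cell i, ∑ k, ∑ j, eulerFlux γ (consVars γ (v t i x)) k j *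
          fderiv ℝ (fun y => w i y k) x (EuclideanSpace.single j 1))
      + (∑ i, boundaryIntegral (M.elem i) fun x n => Fhat (vh t x) (v t i x) n ⬝ᵥ w i x) = 0
  /-- `⟨Fhat, μ⟩_{∂T_h} = 0` for all `μ ∈ M_h` -/
  trace_eq : ∀ t ∈ Icc 0 T, ∀ μ, InTrace M p μ →
    (∑ i, boundaryIntegral (M.elem i) fun x n => Fhat (vh t x) (v t i x) n ⬝ᵥ μ x) = 0

end Boundary

/-- The total generalized entropy `∫_{T_h} H(u(v_h))` at time `t`. -/
def totalEntropy (M : MacroMesh d) (γ : ℝ) (v : ℝ → Fin M.N → Space d → State d) (t : ℝ) : ℝ :=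
  ∑ i, ∫ x in M.cell i, entropy γ (consVars γ (v t i x))

/-! ### `consVars` is the inverse of `entropyVars` -/

theorem density_mk (a : ℝ) (m : Fin d → ℝ) (b : ℝ) : density (mkState a m b) = a := rfl

theorem velocity_mk {a : ℝ} (ha : a ≠ 0) (V : Fin d → ℝ) (b : ℝ) :
    velocity (mkState a (a • V) b) = V := by
  funext i; simp [velocity, density_mk]; field_simp

theorem pressure_mk {γ a c : ℝ} (hγ : 1 < γ) (ha : a ≠ 0) (V : Fin d → ℝ) :
    pressure γ (mkState a (a • V) (c / (γ - 1) + a * (V ⬝ᵥ V) / 2)) = c := by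
  have : γ - 1 ≠ 0 := by linarith
  rw [pressure, velocity_mk ha, density_mk, mkState_en]; field_simp; ring

/-- The conservative variables of an admissible entropy state are physical. -/
theorem physical_consVars {γ : ℝ} (hγ : 1 < γ) {v : State d} (hv : Admissible v) :
    Physical γ (consVars γ v) := by
  have hβ : 0 < -v (enIdx d) := neg_pos.mpr hv
  refine ⟨Real.exp_pos _, ?_⟩
  rw [consVars, pressure_mk hγ (Real.exp_ne_zero _)]
  exact div_pos (Real.exp_pos _) hβ

/-- The entropy variables of a physical state are admissible. -/
theorem admissible_entropyVars {γ : ℝ} {u : State d} (hu : Physical γ u) :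
    Admissible (entropyVars γ u) := by
  rw [Admissible, entropyVars, mkState_en]
  exact neg_neg_of_pos (div_pos hu.1 hu.2)

theorem entropyVars_consVars {γ : ℝ} (hγ : 1 < γ) {v : State d} (hv : Admissible v) :
    entropyVars γ (consVars γ v) = v := by
  have hβ : 0 < -v (enIdx d) := neg_pos.mpr hv
  have hg : γ - 1 ≠ 0 := by linarith
  have hb : v (enIdx d) ≠ 0 := ne_of_lt hv
  set V : Fin d → ℝ := fun i => v (momIdx i) / -v (enIdx d) with hV
  set s : ℝ := γ - (γ - 1) * (v 0 + -v (enIdx d) * (V ⬝ᵥ V) / 2) with hs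
  set ρ : ℝ := Real.exp (-(s + Real.log (-v (enIdx d))) / (γ - 1)) with hρ
  have hρ0 : 0 < ρ := Real.exp_pos _
  have hc : consVars γ v =
      mkState ρ (ρ • V) (ρ / (-v (enIdx d)) / (γ - 1) + ρ * (V ⬝ᵥ V) / 2) := rfl
  have hp : pressure γ (consVars γ v) = ρ / (-v (enIdx d)) := by
    rw [hc, pressure_mk hγ hρ0.ne']
  have hd : density (consVars γ v) = ρ := rfl
  have hvel : velocity (consVars γ v) = V := by rw [hc, velocity_mk hρ0.ne']
  have hbeta : beta γ (consVars γ v) = -v (enIdx d) := by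
    rw [beta, hp, hd]; field_simp
  have hsp : specificEntropy γ (consVars γ v) = s := by
    rw [specificEntropy, hp, hd, Real.log_div (by positivity) (by positivity),
      Real.log_div hρ0.ne' hβ.ne', Real.log_rpow hρ0, hρ, Real.log_exp]
    field_simp; ring
  refine state_ext ?_ (fun i => ?_) ?_
  · rw [entropyVars, mkState_zero, hsp, hbeta, hvel, hs]; field_simp; ring
  · rw [entropyVars, mkState_mom, hbeta, hvel, hV]
    simp only [Pi.smul_apply, smul_eq_mul]; field_simp
  · rw [entropyVars, mkState_en, hbeta, neg_neg]

theorem consVars_entropyVars {γ : ℝ} (hγ : 1 < γ) {u : State d} (hu : Physical γ u) :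
    consVars γ (entropyVars γ u) = u := by
  obtain ⟨h1, h2⟩ := hu
  have hg : γ - 1 ≠ 0 := by linarith
  have hβ : 0 < beta γ u := div_pos h1 h2
  have hV : (fun i => entropyVars γ u (momIdx i) / -entropyVars γ u (enIdx d)) = velocity u := by
    funext i
    simp only [entropyVars, mkState_mom, mkState_en, neg_neg, Pi.smul_apply, smul_eq_mul]
    field_simp
  have hρ : Real.exp (-(γ - (γ - 1) * (entropyVars γ u 0 +
      -entropyVars γ u (enIdx d) * (velocity u ⬝ᵥ velocity u) / 2) +
      Real.log (-entropyVars γ u (enIdx d))) / (γ - 1)) = density u := by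
    have : -(γ - (γ - 1) * (entropyVars γ u 0 +
      -entropyVars γ u (enIdx d) * (velocity u ⬝ᵥ velocity u) / 2) +
      Real.log (-entropyVars γ u (enIdx d))) / (γ - 1) = Real.log (density u) := by
      rw [entropyVars, mkState_zero, mkState_en, neg_neg, specificEntropy, beta,
        Real.log_div h2.ne' (by positivity), Real.log_div h1.ne' h2.ne', Real.log_rpow h1]
      field_simp; ring
    rw [this, Real.exp_log h1]
  have hb : density u / (-entropyVars γ u (enIdx d)) = pressure γ u := by
    rw [entropyVars, mkState_en, neg_neg, beta]; field_simp
  rw [consVars]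
  simp only [hV, hρ, hb]
  refine state_ext rfl (fun i => ?_) ?_
  · simp only [mkState_mom, Pi.smul_apply, smul_eq_mul, velocity]; field_simp
  · rw [mkState_en, pressure]; field_simp; ring

end EntropyHDG

end

/-! The proof tests the scheme with its own solution: `w = v_h` in the cell equation and `μ = v̂_h`
in the trace equation. Each of the three resulting terms is then identified exactly.

Time term. In entropy variables the density is a potential, `∂ρ/∂v = u`, and `H = v · u - ρ` is its
Legendre transform (`hasDerivWithinAt_density`, `entropy_consVars`). Hence `v · ∂ₜu = ∂ₜH`. Time
differentiability is assumed only pointwise in `x`, but `v_h` ranges over polynomials of bounded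
degree on each element. Interpolation at finitely many nodes makes the increments uniformly of first
order, and dominated convergence gives the derivative of the entropy integral
(`hasDerivWithinAt_integral_entropy`).

Volume term. The fluxes in direction `j` form the gradient of `ρ V_j` with respect to `v`
(`hasDerivWithinAt_massFlux`), so `F(u(v)) : ∇v` is the divergence of `ρV`. The divergence theorem
for piecewise C¹ functions on a simplex (`PiecewiseC1.integral_fderiv`) turns its integral into the
boundary integral of `Ψ_n(v)`. That theorem is the one-dimensional fundamental theorem of calculus
along lines parallel to an edge, followed by Fubini; edges span all directions.

Boundary term. Tadmor's identity (`jump_dotProduct_ecFlux`) reads `F̂ · v = F̂ · v̂ - Ψ_n(v̂) +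
Ψ_n(v)`. The logarithmic means are designed to replace jumps of logarithms by jumps of `ρ` and `β`,
which leaves a rational identity. The sum of `F̂ · v̂` vanishes by the trace equation. The sum of
`Ψ_n(v̂)` vanishes because `v̂` is single-valued and periodic while the outward normals cancel
across the skeleton (`sum_inner_normal_mul_integral_eq_zero`). What remains, `Ψ_n(v)`, is exactly
the volume term.

Faces need not match, so normals cannot be paired facet by facet. Instead, applying the divergence
theorem on every translated cell to a compactly supported test function shows that the surface
measures weighted by the positive and by the negative parts of a normal component agree on all of
space (`skeletonMeasure_eq`). Integrating a periodic function over one period then gives the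
cancellation. -/

noncomputable section

namespace EntropyHDG

set_option linter.unusedSectionVars false

/-! ### Barycentric coordinates of a full-dimensional simplex -/

section Bary

variable {d : ℕ} (K : Affine.Simplex ℝ (Space d) d)

/-- The vertices of a full-dimensional simplex as an affine basis. -/
def vertexBasis : AffineBasis (Fin (d + 1)) ℝ (Space d) where
  toFun := K.points
  ind' := K.independent
  tot' := by
    rw [K.independent.affineSpan_eq_top_iff_card_eq_finrank_add_one]
    simp

/-- The barycentric coordinate with respect to the `k`-th vertex. -/
def bary (k : Fin (d + 1)) : Space d →ᵃ[ℝ] ℝ := (vertexBasis K).coord k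

theorem bary_points (k j : Fin (d + 1)) : bary K k (K.points j) = if k = j then 1 else 0 :=
  (vertexBasis K).coord_apply k j

theorem sum_bary (x : Space d) : ∑ k, bary K k x = 1 :=
  (vertexBasis K).sum_coord_apply_eq_one x

theorem affineCombination_bary (x : Space d) :
    Finset.univ.affineCombination ℝ K.points (fun k => bary K k x) = x :=
  (vertexBasis K).affineCombination_coord_eq_self x

theorem closedInterior_eq : K.closedInterior = {x | ∀ k, 0 ≤ bary K k x} := by
  rw [← K.convexHull_eq_closedInterior]
  exact (vertexBasis K).convexHull_eq_nonneg_coord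

theorem mem_closedInterior_iff {x : Space d} : x ∈ K.closedInterior ↔ ∀ k, 0 ≤ bary K k x := by
  rw [closedInterior_eq]; rfl

theorem interior_closedInterior : interior K.closedInterior = {x | ∀ k, 0 < bary K k x} := by
  rw [← K.convexHull_eq_closedInterior]
  exact (vertexBasis K).interior_convexHull

theorem convex_closedInterior : Convex ℝ K.closedInterior := by
  rw [← K.convexHull_eq_closedInterior]
  exact convex_convexHull ℝ _

theorem mem_facet_iff [NeZero d] {k : Fin (d + 1)} {x : Space d} :
    x ∈ (K.faceOpposite k).closedInterior ↔ bary K k x = 0 ∧ ∀ j, 0 ≤ bary K j x := by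
  rw [Affine.Simplex.faceOpposite]
  conv_lhs => rw [← affineCombination_bary K x]
  rw [K.affineCombination_mem_closedInterior_face_iff_nonneg _ (sum_bary K x)]
  simp only [Finset.mem_compl, Finset.mem_singleton, not_not, forall_eq]
  constructor
  · rintro ⟨h1, h2⟩
    exact ⟨h2, fun j => by by_cases h : j = k; · rw [h, h2]
                           · exact h1 j h⟩
  · rintro ⟨h1, h2⟩
    exact ⟨fun j _ => h2 j, h1⟩

theorem frontier_closedInterior [NeZero d] :
    frontier K.closedInterior = ⋃ k, (K.faceOpposite k).closedInterior := by
  ext x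
  rw [K.isClosed_closedInterior.frontier_eq, interior_closedInterior, mem_sdiff, mem_iUnion,
    mem_closedInterior_iff]
  simp only [mem_facet_iff, mem_ofPred_eq, not_forall, not_lt]
  exact ⟨fun ⟨h1, k, hk⟩ => ⟨k, le_antisymm hk (h1 k), h1⟩,
    fun ⟨k, hk, h1⟩ => ⟨h1, k, hk.le⟩⟩

theorem volume_bary_eq_zero (k : Fin (d + 1)) : volume {x | bary K k x = 0} = 0 := by
  have h := Measure.addHaar_affineSubspace (volume : Measure (Space d))
    ((AffineSubspace.mk' (0 : ℝ) ⊥).comap (bary K k)) (by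
      intro h
      have : K.points k ∈ (AffineSubspace.mk' (0 : ℝ) ⊥).comap (bary K k) := by
        rw [h]; trivial
      simp [AffineSubspace.mem_comap, AffineSubspace.mem_mk', bary_points] at this)
  convert h using 2
  ext x
  simp [AffineSubspace.mem_mk']

end Bary

/-! ### Charts of a simplex based on one of its edges -/

section Chart

variable {d : ℕ} (K : Affine.Simplex ℝ (Space d) d) (a b : Fin (d + 1))

/-- The vertices that do not belong to the edge `a b`. -/
abbrev OtherIdx {d : ℕ} (a b : Fin (d + 1)) : Type := {c : Fin (d + 1) // c ≠ a ∧ c ≠ b}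

theorem card_otherIdx {a b : Fin (d + 1)} (hab : a ≠ b) :
    Fintype.card (OtherIdx a b) = d - 1 := by
  rw [Fintype.card_subtype]
  have : (Finset.univ.filter fun c => c ≠ a ∧ c ≠ b) = ({a, b} : Finset (Fin (d + 1)))ᶜ := by
    ext c; simp
  rw [this, Finset.card_compl, Finset.card_pair hab, Fintype.card_fin]
  omega

/-- The linear map with values `p_c - p_o` on the standard basis. It parametrizes the direction of
the facet opposite to `a` if `o = b`, and of the facet opposite to `b` if `o = a`. -/
def facetMap (o : Fin (d + 1)) : EuclideanSpace ℝ (OtherIdx a b) →ₗ[ℝ] Space d where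
  toFun y := ∑ c : OtherIdx a b, y c • (K.points c - K.points o)
  map_add' y z := by simp [add_smul, Finset.sum_add_distrib]
  map_smul' r y := by simp [mul_smul, Finset.smul_sum]

theorem facetMap_apply (o : Fin (d + 1)) (y : EuclideanSpace ℝ (OtherIdx a b)) :
    facetMap K a b o y = ∑ c : OtherIdx a b, y c • (K.points c - K.points o) := rfl

/-- The linear part of the chart. -/
def chartLin : EuclideanSpace ℝ (OtherIdx a b) × ℝ →ₗ[ℝ] Space d :=
  (facetMap K a b b).coprod (LinearMap.toSpanSingleton ℝ _ (K.points a - K.points b))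

theorem chartLin_apply (q : EuclideanSpace ℝ (OtherIdx a b) × ℝ) :
    chartLin K a b q = facetMap K a b b q.1 + q.2 • (K.points a - K.points b) := by
  simp [chartLin]

/-- Since `p_c - p_a = (p_c - p_b) - (p_a - p_b)`, moving the origin from `b` to `a` is a shear in
the chart. This lets one chart describe both facets that meet the edge in a single endpoint. -/
theorem facetMap_eq_chartLin (y : EuclideanSpace ℝ (OtherIdx a b)) :
    facetMap K a b a y = chartLin K a b (y, -∑ c, y c) := by
  rw [chartLin_apply, facetMap_apply, facetMap_apply, neg_smul, Finset.sum_smul, ← sub_eq_add_neg,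
    ← Finset.sum_sub_distrib]
  refine Finset.sum_congr rfl fun c _ => ?_
  rw [← smul_sub]; congr 1; abel

theorem bary_linear_sub (k i j : Fin (d + 1)) :
    (bary K k).linear (K.points i - K.points j) =
      (if k = i then 1 else 0) - (if k = j then 1 else 0) := by
  rw [← vsub_eq_sub, AffineMap.linearMap_vsub, bary_points, bary_points, vsub_eq_sub]

theorem bary_linear_chartLin_edge (hab : a ≠ b) (q : EuclideanSpace ℝ (OtherIdx a b) × ℝ) :
    (bary K a).linear (chartLin K a b q) = q.2 := by
  rw [chartLin_apply, facetMap_apply, map_add, map_sum]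
  simp only [map_smul, bary_linear_sub, smul_eq_mul, hab, if_true, if_false]
  rw [Finset.sum_eq_zero]
  · simp
  · intro c _
    rw [if_neg (Ne.symm c.2.1)]; simp

theorem bary_linear_chartLin_other (k : OtherIdx a b) (q : EuclideanSpace ℝ (OtherIdx a b) × ℝ) :
    (bary K k).linear (chartLin K a b q) = q.1 k := by
  rw [chartLin_apply, facetMap_apply, map_add, map_sum]
  simp only [map_smul, bary_linear_sub, smul_eq_mul, k.2.1, k.2.2, if_false]
  rw [Finset.sum_eq_single k]
  · simp
  · intro c _ hc
    rw [if_neg (fun h => hc (Subtype.ext h.symm))]; simp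
  · simp

/-- The affine parametrization of space with base edge `a b`. -/
def chart (q : EuclideanSpace ℝ (OtherIdx a b) × ℝ) : Space d :=
  K.points b + chartLin K a b q

theorem bary_chart (k : Fin (d + 1)) (q : EuclideanSpace ℝ (OtherIdx a b) × ℝ) :
    bary K k (chart K a b q) = (bary K k).linear (chartLin K a b q) + if k = b then 1 else 0 := by
  rw [chart, add_comm (K.points b), ← vadd_eq_add, AffineMap.map_vadd, bary_points, vadd_eq_add]

variable {a b} in
theorem bary_chart_edge (hab : a ≠ b) (q : EuclideanSpace ℝ (OtherIdx a b) × ℝ) :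
    bary K a (chart K a b q) = q.2 := by
  rw [bary_chart, bary_linear_chartLin_edge K a b hab, if_neg hab, add_zero]

theorem bary_chart_other (k : OtherIdx a b) (q : EuclideanSpace ℝ (OtherIdx a b) × ℝ) :
    bary K k (chart K a b q) = q.1 k := by
  have h := bary_chart K a b k q
  rwa [bary_linear_chartLin_other, if_neg k.2.2, add_zero] at h

variable {a b} in
theorem sum_eq_edge_add (hab : a ≠ b) (f : Fin (d + 1) → ℝ) :
    ∑ k, f k = f a + f b + ∑ c : OtherIdx a b, f c := by
  have h1 : ({a, b} : Finset (Fin (d + 1)))ᶜ = Finset.univ.filter fun c => c ≠ a ∧ c ≠ b := by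
    ext c; simp
  rw [← Finset.sum_add_sum_compl ({a, b} : Finset (Fin (d + 1))), Finset.sum_pair hab, h1,
    ← Finset.sum_subtype_eq_sum_filter]
  congr 1
  refine Finset.sum_congr ?_ fun _ _ => rfl
  ext c; simp

variable {a b} in
theorem bary_chart_base (hab : a ≠ b) (q : EuclideanSpace ℝ (OtherIdx a b) × ℝ) :
    bary K b (chart K a b q) = 1 - ∑ c, q.1 c - q.2 := by
  have h := sum_bary K (chart K a b q)
  rw [sum_eq_edge_add hab, bary_chart_edge K hab] at h
  simp only [bary_chart_other] at h
  linarith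

variable {a b} in
theorem forall_bary_chart_iff (hab : a ≠ b) (P : ℝ → Prop)
    (q : EuclideanSpace ℝ (OtherIdx a b) × ℝ) :
    (∀ k, P (bary K k (chart K a b q))) ↔
      (∀ c, P (q.1 c)) ∧ P q.2 ∧ P (1 - ∑ c, q.1 c - q.2) := by
  rw [← bary_chart_base K hab, ← bary_chart_edge K hab]
  simp only [← bary_chart_other K a b]
  refine ⟨fun h => ⟨fun c => h _, h _, h _⟩, fun ⟨h1, h2, h3⟩ k => ?_⟩
  by_cases ha : k = a
  · rw [ha]; exact h2
  by_cases hb : k = b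
  · rw [hb]; exact h3
  exact h1 ⟨k, ha, hb⟩

variable {a b} in
/-- The linear part of the chart is an isomorphism. -/
def chartEquiv [NeZero d] (hab : a ≠ b) : (EuclideanSpace ℝ (OtherIdx a b) × ℝ) ≃L[ℝ] Space d :=
  (LinearMap.linearEquivOfInjective (chartLin K a b) (by
    rw [← LinearMap.ker_eq_bot, LinearMap.ker_eq_bot']
    intro q hq
    refine Prod.ext ?_ ?_
    · ext c
      rw [← bary_linear_chartLin_other K a b c q, hq]; simp
    · rw [← bary_linear_chartLin_edge K a b hab q, hq]; simp) (by
    have := NeZero.pos d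
    rw [Module.finrank_prod, finrank_euclideanSpace, card_otherIdx hab]
    simp; omega)).toContinuousLinearEquiv

variable {a b} in
theorem chartEquiv_apply [NeZero d] (hab : a ≠ b) (q : EuclideanSpace ℝ (OtherIdx a b) × ℝ) :
    chartEquiv K hab q = chartLin K a b q := rfl

end Chart

/-! ### Surface measure of the facets in charts -/

/-- The volume of an oblique prism: base times height. -/
theorem jacobian_eq_inner_mul_normDet {d : ℕ} {U : Type*} [NormedAddCommGroup U]
    [InnerProductSpace ℝ U] [FiniteDimensional ℝ U] [MeasurableSpace U] [BorelSpace U]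
    (hU : Module.finrank ℝ U = d - 1) (f : U →ₗ[ℝ] Space d) (w n : Space d) (hn : ‖n‖ = 1)
    (hf : ∀ y, inner ℝ n (f y) = 0) (hw : 0 < inner ℝ n w) (D : ENNReal)
    (hD : (volume : Measure (Space d)) =
      D • (volume : Measure (U × ℝ)).map (fun q => f q.1 + q.2 • w))
    (hinj : Function.Injective (fun q : U × ℝ => f q.1 + q.2 • w)) :
    D = ENNReal.ofReal (inner ℝ n w) * ENNReal.ofReal f.normDet := by
  set L : U × ℝ → Space d := fun q => f q.1 + q.2 • w with hL
  have hfc : Continuous f := f.continuous_of_finiteDimensional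
  have hLc : Continuous L := by fun_prop
  have hLe : MeasurableEmbedding L := hLc.measurableEmbedding hinj
  -- The base of the prism. Only its nonzero finite volume matters, since it cancels at the end.
  set B : Set U := Metric.closedBall 0 1 with hB
  have hBpos : volume B ≠ 0 := (Metric.measure_closedBall_pos volume 0 one_pos).ne'
  have hBtop : volume B ≠ ⊤ := (isCompact_closedBall (0 : U) 1).measure_ne_top
  set β : ℝ := inner ℝ n w with hβ
  have hP : MeasurableSet (B ×ˢ Icc (0 : ℝ) 1) :=
    (Metric.isClosed_closedBall.measurableSet).prod measurableSet_Icc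
  have ht : MeasurableSet (L '' (B ×ˢ Icc (0 : ℝ) 1)) := hLe.measurableSet_image.2 hP
  have h1 : volume (L '' (B ×ˢ Icc (0 : ℝ) 1)) = D * volume B := by
    conv_lhs => rw [hD]
    rw [Measure.smul_apply, hLe.map_apply, preimage_image_eq _ hinj, Measure.volume_eq_prod,
      Measure.prod_prod]
    simp
  have hn0 : n ≠ 0 := by rintro rfl; simp at hn
  -- Cavalieri: the prism is sliced by hyperplanes orthogonal to `n`, and its volume is compared
  -- with `D * volume B`.
  have h2 := EuclideanGeometry.euclideanHausdorffMeasure_eq_lintegral (0 : Space d) hn0 ht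
  rw [InnerProductSpace.euclideanHausdorffMeasure_eq_volume, h1] at h2
  have hslice : ∀ τ : ℝ, Measure.euclideanHausdorffMeasure (Module.finrank ℝ (Space d) - 1)
      (L '' (B ×ˢ Icc (0 : ℝ) 1) ∩ AffineSubspace.mk' (τ • n +ᵥ (0 : Space d)) (ℝ ∙ n)ᗮ) =
      (Icc 0 β).indicator (fun _ => ENNReal.ofReal f.normDet * volume B) τ := by
    intro τ
    have hmem : ∀ q : U × ℝ,
        L q ∈ AffineSubspace.mk' (τ • n +ᵥ (0 : Space d)) (ℝ ∙ n)ᗮ ↔ q.2 * β = τ := by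
      intro q
      rw [AffineSubspace.mem_mk', Submodule.mem_orthogonal_singleton_iff_inner_right]
      simp only [hL, vadd_eq_add, vsub_eq_sub, add_zero, inner_sub_right, inner_add_right,
        inner_smul_right, hf, real_inner_self_eq_norm_sq, hn]
      rw [← hβ, sub_eq_zero]; simp
    by_cases hτ : τ ∈ Icc 0 β
    · rw [indicator_of_mem hτ]
      -- The image of `f` is orthogonal to `n`, so height `τ` forces the last coordinate to be `τ /
      -- β`. Each slice is a translate of `f '' B`.
      have : L '' (B ×ˢ Icc (0 : ℝ) 1) ∩ AffineSubspace.mk' (τ • n +ᵥ (0 : Space d)) (ℝ ∙ n)ᗮ =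
          (fun x => ((τ / β) • w) +ᵥ x) '' (f '' B) := by
        ext x
        constructor
        · rintro ⟨⟨q, ⟨hq1, hq2⟩, rfl⟩, hx⟩
          refine ⟨f q.1, ⟨q.1, hq1, rfl⟩, ?_⟩
          have := (hmem q).1 hx
          rw [← this]
          simp only [hL, vadd_eq_add]
          rw [mul_div_cancel_right₀ _ hw.ne', add_comm]
        · rintro ⟨_, ⟨y, hy, rfl⟩, rfl⟩
          have e : (τ / β) • w +ᵥ f y = L (y, τ / β) := by simp [hL, add_comm]
          refine ⟨⟨(y, τ / β), ⟨hy, ?_⟩, e.symm⟩, ?_⟩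
          · exact ⟨div_nonneg hτ.1 hw.le, (div_le_one hw).2 hτ.2⟩
          · simp only [e]
            exact (hmem _).2 (by simp; field_simp)
      rw [this, image_vadd, measure_vadd]
      have hr : Module.finrank ℝ (Space d) - 1 = Module.finrank ℝ U := by simp [hU]
      rw [hr, f.euclideanHausdorffMeasure_image_eq_normDet_mul_volume]
    · rw [indicator_of_notMem hτ]
      have : L '' (B ×ˢ Icc (0 : ℝ) 1) ∩ AffineSubspace.mk' (τ • n +ᵥ (0 : Space d)) (ℝ ∙ n)ᗮ =
          ∅ := by
        rw [eq_empty_iff_forall_notMem]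
        rintro _ ⟨⟨q, ⟨hq1, hq2⟩, rfl⟩, hx⟩
        have := (hmem q).1 hx
        exact hτ ⟨this ▸ mul_nonneg hq2.1 hw.le, this ▸ mul_le_of_le_one_left hw.le hq2.2⟩
      rw [this, measure_empty]
  simp_rw [hslice] at h2
  rw [lintegral_indicator measurableSet_Icc, setLIntegral_const, Real.volume_Icc, sub_zero,
    ← ofReal_norm, hn, ENNReal.ofReal_one, one_mul, mul_right_comm] at h2
  rw [(ENNReal.mul_left_inj hBpos hBtop).1 h2, mul_comm]

/-! ### Outward normals against edge vectors -/

section Normal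

variable {d : ℕ} [NeZero d] (K : Affine.Simplex ℝ (Space d) d)

theorem norm_outwardNormal (k : Fin (d + 1)) : ‖outwardNormal K k‖ = 1 := by
  have h := K.height_pos k
  rw [outwardNormal, norm_smul, norm_inv, Real.norm_of_nonneg h.le, ← dist_eq_norm, dist_comm]
  exact inv_mul_cancel₀ h.ne'

/-- Every edge leaving the vertex `k` ends in the opposite facet, so its projection on the altitude
is the whole altitude. -/
theorem inner_outwardNormal_edge {k j : Fin (d + 1)} (h : k ≠ j) :
    inner ℝ (outwardNormal K k) (K.points k - K.points j) = -K.height k := by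
  have h1 := K.inner_vsub_vsub_altitudeFoot_eq_height_sq h
  have h2 := K.height_pos k
  have e : K.altitudeFoot k - K.points k = -(K.points k -ᵥ K.altitudeFoot k) := by
    simp
  rw [outwardNormal, inner_smul_left, e, inner_neg_left, real_inner_comm, ← vsub_eq_sub, h1]
  simp; field_simp

theorem inner_outwardNormal_of_ne {k i j : Fin (d + 1)} (hi : k ≠ i) (hj : k ≠ j) :
    inner ℝ (outwardNormal K k) (K.points i - K.points j) = 0 := by
  have e : K.points i - K.points j = (K.points k - K.points j) - (K.points k - K.points i) := by
    abel
  rw [e, inner_sub_right, inner_outwardNormal_edge K hi, inner_outwardNormal_edge K hj, sub_self]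

end Normal

/-! ### Surface measure of the two facets at an edge, in one chart -/

section Facet

variable {d : ℕ} [NeZero d] (K : Affine.Simplex ℝ (Space d) d) {a b : Fin (d + 1)}

/-- The Jacobian of the chart, as a Haar scalar factor. -/
def chartJac (hab : a ≠ b) : NNReal :=
  have : (volume : Measure (EuclideanSpace ℝ (OtherIdx a b) × ℝ)).IsAddHaarMeasure := by
    rw [Measure.volume_eq_prod]; infer_instance
  Measure.addHaarScalarFactor (volume : Measure (Space d))
    ((volume : Measure (EuclideanSpace ℝ (OtherIdx a b) × ℝ)).map (chartEquiv K hab))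

theorem volume_eq_map_chartLin (hab : a ≠ b) : (volume : Measure (Space d)) =
    (chartJac K hab : ENNReal) • (volume : Measure (EuclideanSpace ℝ (OtherIdx a b) × ℝ)).map
      (chartLin K a b) := by
  have : (volume : Measure (EuclideanSpace ℝ (OtherIdx a b) × ℝ)).IsAddHaarMeasure := by
    rw [Measure.volume_eq_prod]; infer_instance
  exact Measure.isAddLeftInvariant_eq_smul _ _

theorem continuous_chart : Continuous (chart K a b) :=
  continuous_const.add (chartLin K a b).continuous_of_finiteDimensional

theorem chart_injective (hab : a ≠ b) : Function.Injective (chart K a b) := fun x y h => by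
  have h : chartLin K a b x = chartLin K a b y := by simpa [chart] using h
  exact (chartEquiv K hab).injective h

theorem chart_surjective (hab : a ≠ b) : Function.Surjective (chart K a b) := fun x => by
  obtain ⟨q, hq⟩ := (chartEquiv K hab).surjective (x - K.points b)
  exact ⟨q, by rw [chart, ← chartEquiv_apply K hab, hq]; abel⟩

theorem measurableEmbedding_chart (hab : a ≠ b) : MeasurableEmbedding (chart K a b) :=
  (continuous_chart K).measurableEmbedding (chart_injective K hab)

theorem volume_eq_map_chart (hab : a ≠ b) : (volume : Measure (Space d)) =
    (chartJac K hab : ENNReal) • (volume : Measure (EuclideanSpace ℝ (OtherIdx a b) × ℝ)).map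
      (chart K a b) := by
  have h : chart K a b = (fun x => K.points b + x) ∘ chartLin K a b := rfl
  have hm : Measurable (chartLin K a b) :=
    (chartLin K a b).continuous_of_finiteDimensional.measurable
  rw [h, ← Measure.map_map (measurable_const_add _) hm, ← Measure.map_smul,
    ← volume_eq_map_chartLin K hab, Measure.IsAddLeftInvariant.map_add_left_eq_self]

/-- Change of base point in the chart is a shear. -/
theorem measurePreserving_shear (ι : Type*) [Fintype ι] :
    MeasurePreserving (fun q : EuclideanSpace ℝ ι × ℝ => (q.1, -∑ c, q.1 c - q.2)) := by
  rw [Measure.volume_eq_prod]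
  refine MeasurePreserving.skew_product (g := fun (y : EuclideanSpace ℝ ι) s => -∑ c, y c - s)
    (MeasurePreserving.id _) (by fun_prop) (Filter.Eventually.of_forall fun y => ?_)
  exact (Measure.measurePreserving_sub_left volume (-∑ c, y c)).map_eq

theorem finrank_otherIdx (hab : a ≠ b) : Module.finrank ℝ (EuclideanSpace ℝ (OtherIdx a b)) = d - 1 := by
  rw [finrank_euclideanSpace, card_otherIdx hab]

/-- Height times area density of a facet is the Jacobian of the chart. Together with
`chartJac_eq_right` this gives both facets the same constant, which is what integration along the
edge requires. -/
theorem chartJac_eq_left (hab : a ≠ b) :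
    (chartJac K hab : ENNReal) =
      ENNReal.ofReal (K.height a) * ENNReal.ofReal (facetMap K a b b).normDet := by
  have h0 : inner ℝ (-outwardNormal K a) (K.points a - K.points b) = K.height a := by
    rw [inner_neg_left, inner_outwardNormal_edge K hab, neg_neg]
  have key := jacobian_eq_inner_mul_normDet (finrank_otherIdx hab) (facetMap K a b b)
    (K.points a - K.points b) (-outwardNormal K a) (by rw [norm_neg, norm_outwardNormal])
    (fun y => ?_) (by rw [h0]; exact K.height_pos a) (chartJac K hab)
    ?_ ?_
  · rwa [h0] at key
  · rw [inner_neg_left, facetMap_apply, inner_sum, Finset.sum_eq_zero, neg_zero]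
    intro c _
    rw [inner_smul_right, inner_outwardNormal_of_ne K (Ne.symm c.2.1) hab, mul_zero]
  · have := volume_eq_map_chartLin K hab
    convert this using 3
    ext1 q
    rw [chartLin_apply]
  · intro x y h
    simp only [← chartLin_apply] at h
    exact (chartEquiv K hab).injective h

/-- The chart based at the other endpoint differs by a volume-preserving shear, so its Jacobian is
the same. -/
theorem chartJac_eq_right (hab : a ≠ b) :
    (chartJac K hab : ENNReal) =
      ENNReal.ofReal (K.height b) * ENNReal.ofReal (facetMap K a b a).normDet := by
  have h0 : inner ℝ (-outwardNormal K b) (K.points b - K.points a) = K.height b := by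
    rw [inner_neg_left, inner_outwardNormal_edge K hab.symm, neg_neg]
  have hT := measurePreserving_shear (OtherIdx a b)
  have hL : (fun q : EuclideanSpace ℝ (OtherIdx a b) × ℝ =>
      facetMap K a b a q.1 + q.2 • (K.points b - K.points a)) =
      chartLin K a b ∘ fun q => (q.1, -∑ c, q.1 c - q.2) := by
    ext1 q
    rw [facetMap_eq_chartLin, Function.comp_apply, chartLin_apply, chartLin_apply, sub_smul,
      smul_sub, smul_sub]
    simp only
    rw [smul_sub]
    abel
  have key := jacobian_eq_inner_mul_normDet (finrank_otherIdx hab) (facetMap K a b a)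
    (K.points b - K.points a) (-outwardNormal K b) (by rw [norm_neg, norm_outwardNormal])
    (fun y => ?_) (by rw [h0]; exact K.height_pos b) (chartJac K hab)
    ?_ ?_
  · rwa [h0] at key
  · rw [inner_neg_left, facetMap_apply, inner_sum, Finset.sum_eq_zero, neg_zero]
    intro c _
    rw [inner_smul_right, inner_outwardNormal_of_ne K (Ne.symm c.2.2) hab.symm, mul_zero]
  · rw [hL, ← Measure.map_map (chartLin K a b).continuous_of_finiteDimensional.measurable
      hT.measurable, hT.map_eq]
    exact volume_eq_map_chartLin K hab
  · rw [hL]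
    refine (chartEquiv K hab).injective.comp fun x y h => ?_
    simp only [Prod.mk.injEq] at h
    refine Prod.ext h.1 ?_
    have h2 := h.2
    rw [h.1] at h2
    linarith

variable (a b) in
/-- The reference simplex parametrizing the facets opposite to `a` and `b`. -/
def refSimplex : Set (EuclideanSpace ℝ (OtherIdx a b)) :=
  {y | (∀ c, 0 ≤ y c) ∧ 0 ≤ 1 - ∑ c, y c}

theorem isCompact_refSimplex : IsCompact (refSimplex a b) := by
  refine Metric.isCompact_of_isClosed_isBounded ?_ ?_
  · rw [refSimplex, ofPred_and, ofPred_forall]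
    refine (isClosed_iInter fun c => ?_).inter ?_
    · exact isClosed_le continuous_const (by fun_prop)
    · exact isClosed_le continuous_const (by fun_prop)
  -- All coordinates lie in `[0, 1]`, whence the radius `√card`.
  · refine (Metric.isBounded_closedBall (x := (0 : EuclideanSpace ℝ (OtherIdx a b)))
      (r := Real.sqrt (Fintype.card (OtherIdx a b)))).subset fun y hy => ?_
    rw [mem_closedBall_zero_iff, EuclideanSpace.norm_eq]
    refine Real.sqrt_le_sqrt ?_
    have : ∀ c ∈ Finset.univ, ‖y c‖ ^ 2 ≤ 1 := fun c _ => by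
      have h1 : y c ≤ ∑ c, y c := Finset.single_le_sum (fun i _ => hy.1 i) (Finset.mem_univ c)
      have h3 := hy.2
      rw [Real.norm_of_nonneg (hy.1 c)]
      exact pow_le_one₀ (hy.1 c) (by linarith)
    refine (Finset.sum_le_sum this).trans (by simp)

theorem measurableSet_refSimplex : MeasurableSet (refSimplex a b) :=
  isCompact_refSimplex.measurableSet

theorem facet_left_eq (hab : a ≠ b) : (K.faceOpposite a).closedInterior =
    (fun y => K.points b + facetMap K a b b y) '' refSimplex a b := by
  have hch : ∀ y, K.points b + facetMap K a b b y = chart K a b (y, 0) := fun y => by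
    rw [chart, chartLin_apply]; simp
  simp only [hch]
  ext x
  obtain ⟨⟨y, s⟩, rfl⟩ := chart_surjective K hab x
  rw [mem_facet_iff, forall_bary_chart_iff K hab (fun r => 0 ≤ r), bary_chart_edge K hab]
  constructor
  · rintro ⟨h1, h2, h3, h4⟩
    simp only at h1 h2 h4
    subst h1
    exact ⟨y, ⟨h2, by simpa using h4⟩, rfl⟩
  · rintro ⟨z, hz, h⟩
    obtain ⟨rfl, rfl⟩ := Prod.mk.inj (chart_injective K hab h)
    exact ⟨rfl, hz.1, le_rfl, by simpa using hz.2⟩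

theorem chart_right (y : EuclideanSpace ℝ (OtherIdx a b)) :
    K.points a + facetMap K a b a y = chart K a b (y, 1 - ∑ c, y c) := by
  rw [chart, facetMap_eq_chartLin, chartLin_apply, chartLin_apply]
  simp only
  rw [sub_smul, one_smul, neg_smul]
  abel

theorem facet_right_eq (hab : a ≠ b) : (K.faceOpposite b).closedInterior =
    (fun y => K.points a + facetMap K a b a y) '' refSimplex a b := by
  simp only [chart_right]
  ext x
  obtain ⟨⟨y, s⟩, rfl⟩ := chart_surjective K hab x
  rw [mem_facet_iff, forall_bary_chart_iff K hab (fun r => 0 ≤ r), bary_chart_base K hab]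
  constructor
  · rintro ⟨h1, h2, h3, h4⟩
    simp only at h1 h2 h3
    obtain rfl : s = 1 - ∑ c, y c := by linarith
    exact ⟨y, ⟨h2, h3⟩, rfl⟩
  · rintro ⟨z, hz, h⟩
    obtain ⟨rfl, rfl⟩ := Prod.mk.inj (chart_injective K hab h)
    exact ⟨by simp, hz.1, hz.2, by simp⟩

theorem restrict_image_facetMap (hab : a ≠ b) (o : Fin (d + 1)) (p : Space d)
    (S : Set (EuclideanSpace ℝ (OtherIdx a b))) :
    (Measure.euclideanHausdorffMeasure (d - 1)).restrict
        ((fun y => p + facetMap K a b o y) '' S) =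
      ENNReal.ofReal (facetMap K a b o).normDet •
        ((volume : Measure (EuclideanSpace ℝ (OtherIdx a b))).restrict S).map
          (fun y => p + facetMap K a b o y) := by
  have hc : Continuous (fun y => p + facetMap K a b o y) :=
    continuous_const.add (facetMap K a b o).continuous_of_finiteDimensional
  refine Measure.ext fun A hA => ?_
  rw [Measure.restrict_apply hA, Measure.smul_apply, Measure.map_apply hc.measurable hA,
    Measure.restrict_apply (hc.measurable hA), ← image_preimage_inter]
  have : (fun y => p + facetMap K a b o y) = (fun x => p +ᵥ x) ∘ facetMap K a b o := rfl
  conv_lhs => rw [this, image_comp, image_vadd, measure_vadd]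
  rw [← finrank_otherIdx (d := d) hab, (facetMap K a b o).euclideanHausdorffMeasure_image_eq_normDet_mul_volume]
  rfl

/-- The factor `K.height a` combines with the area density of the facet into the chart Jacobian, by
`chartJac_eq_left`. -/
theorem height_smul_integral_left (hab : a ≠ b) (g : Space d → ℝ) :
    K.height a * ∫ x in (K.faceOpposite a).closedInterior, g x
        ∂(Measure.euclideanHausdorffMeasure (d - 1)) =
      chartJac K hab * ∫ y in refSimplex a b, g (chart K a b (y, 0)) := by
  have hch : ∀ y, K.points b + facetMap K a b b y = chart K a b (y, 0) := fun y => by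
    rw [chart, chartLin_apply]; simp
  have hinj : Function.Injective fun y => K.points b + facetMap K a b b y := fun x y h => by
    simp only [hch] at h
    exact (Prod.mk.inj (chart_injective K hab h)).1
  have he : MeasurableEmbedding fun y => K.points b + facetMap K a b b y :=
    (continuous_const.add
      (facetMap K a b b).continuous_of_finiteDimensional).measurableEmbedding hinj
  rw [facet_left_eq K hab, restrict_image_facetMap K hab b _ _,
    integral_smul_measure, he.integral_map, smul_eq_mul, ← mul_assoc,
    ENNReal.toReal_ofReal (LinearMap.normDet_nonneg _)]
  simp only [hch]
  congr 1
  have := congrArg ENNReal.toReal (chartJac_eq_left K hab)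
  rw [ENNReal.toReal_mul, ENNReal.toReal_ofReal (K.height_pos a).le,
    ENNReal.toReal_ofReal (LinearMap.normDet_nonneg _)] at this
  exact this.symm

theorem height_smul_integral_right (hab : a ≠ b) (g : Space d → ℝ) :
    K.height b * ∫ x in (K.faceOpposite b).closedInterior, g x
        ∂(Measure.euclideanHausdorffMeasure (d - 1)) =
      chartJac K hab * ∫ y in refSimplex a b, g (chart K a b (y, 1 - ∑ c, y c)) := by
  have hinj : Function.Injective fun y => K.points a + facetMap K a b a y := fun x y h => by
    simp only [chart_right] at h
    exact (Prod.mk.inj (chart_injective K hab h)).1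
  have he : MeasurableEmbedding fun y => K.points a + facetMap K a b a y :=
    (continuous_const.add
      (facetMap K a b a).continuous_of_finiteDimensional).measurableEmbedding hinj
  rw [facet_right_eq K hab, restrict_image_facetMap K hab a _ _,
    integral_smul_measure, he.integral_map, smul_eq_mul, ← mul_assoc,
    ENNReal.toReal_ofReal (LinearMap.normDet_nonneg _)]
  simp only [chart_right]
  congr 1
  have := congrArg ENNReal.toReal (chartJac_eq_right K hab)
  rw [ENNReal.toReal_mul, ENNReal.toReal_ofReal (K.height_pos b).le,
    ENNReal.toReal_ofReal (LinearMap.normDet_nonneg _)] at this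
  exact this.symm

theorem facet_measure_lt_top (k : Fin (d + 1)) :
    Measure.euclideanHausdorffMeasure (d - 1) (K.faceOpposite k).closedInterior < ⊤ := by
  have hd := NeZero.pos d
  obtain ⟨o, ho⟩ : ∃ o, k ≠ o := by
    have : Nontrivial (Fin (d + 1)) := Fin.nontrivial_iff_two_le.2 (by omega)
    obtain ⟨o, ho⟩ := exists_ne k
    exact ⟨o, ho.symm⟩
  have h := restrict_image_facetMap K ho o (K.points o) (refSimplex k o)
  rw [← facet_left_eq K ho] at h
  have h2 := congrArg (fun μ => μ univ) h
  have hc : Continuous (fun y => K.points o + facetMap K k o o y) :=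
    continuous_const.add (facetMap K k o o).continuous_of_finiteDimensional
  simp only [Measure.restrict_apply MeasurableSet.univ, univ_inter, Measure.smul_apply] at h2
  rw [Measure.map_apply hc.measurable MeasurableSet.univ, preimage_univ,
    Measure.restrict_apply MeasurableSet.univ, univ_inter] at h2
  rw [h2]
  refine ENNReal.mul_lt_top ENNReal.ofReal_lt_top ?_
  exact isCompact_refSimplex.measure_lt_top

end Facet

/-! ### The divergence theorem for piecewise continuously differentiable functions on a simplex -/

section Divergence

variable {d : ℕ}

/-- `g` is continuous on `K` and continuously differentiable on each simplex of the finite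
subdivision `S` of `K`. -/
structure PiecewiseC1 {σ : Type*} (K : Affine.Simplex ℝ (Space d) d)
    (S : σ → Affine.Simplex ℝ (Space d) d) (g : Space d → ℝ) : Prop where
  cover : ⋃ a, (S a).closedInterior = K.closedInterior
  continuousOn : ContinuousOn g K.closedInterior
  piece : ∀ a, ∃ G : Space d → ℝ, (∀ x ∈ (S a).closedInterior, ContDiffAt ℝ 1 G x) ∧
    EqOn g G (S a).closedInterior

/-- `x` lies on none of the hyperplanes spanned by the facets of the simplices `S a`. -/
def OffFacets {σ : Type*} (S : σ → Affine.Simplex ℝ (Space d) d) (x : Space d) : Prop :=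
  ∀ a k, bary (S a) k x ≠ 0

theorem ae_offFacets {σ : Type*} [Countable σ] (S : σ → Affine.Simplex ℝ (Space d) d) :
    ∀ᵐ x : Space d, OffFacets S x := by
  simp only [OffFacets, ae_all_iff]
  intro a k
  rw [ae_iff]
  simpa using volume_bary_eq_zero (S a) k

variable {σ : Type*} {K : Affine.Simplex ℝ (Space d) d}
  {S : σ → Affine.Simplex ℝ (Space d) d} {g : Space d → ℝ}

/-- Nonnegative barycentric coordinates that do not vanish are positive, so the point is interior to
whichever piece contains it. -/
theorem OffFacets.exists_mem_interior {x : Space d} (hx : OffFacets S x)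
    (hcover : ⋃ a, (S a).closedInterior = K.closedInterior) (hK : x ∈ K.closedInterior) :
    ∃ a, x ∈ interior (S a).closedInterior := by
  rw [← hcover, mem_iUnion] at hK
  obtain ⟨a, ha⟩ := hK
  refine ⟨a, ?_⟩
  rw [interior_closedInterior]
  exact fun k => lt_of_le_of_ne ((mem_closedInterior_iff _).1 ha k) (hx a k).symm

namespace PiecewiseC1

theorem differentiableAt (hg : PiecewiseC1 K S g) {x : Space d} (hx : OffFacets S x)
    (hK : x ∈ K.closedInterior) : DifferentiableAt ℝ g x := by
  obtain ⟨a, ha⟩ := hx.exists_mem_interior hg.cover hK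
  obtain ⟨G, hG, hgG⟩ := hg.piece a
  exact ((hG x (interior_subset ha)).differentiableAt one_ne_zero).congr_of_eventuallyEq
    (Filter.eventuallyEq_of_mem (mem_interior_iff_mem_nhds.1 ha) hgG)

/-- Inside a piece the derivative is that of the extension `G`, which is continuous up to the
boundary of the compact piece. There are finitely many pieces. -/
theorem exists_bound [Finite σ] (hg : PiecewiseC1 K S g) :
    ∃ C, ∀ x ∈ K.closedInterior, OffFacets S x → ‖fderiv ℝ g x‖ ≤ C := by
  have h : ∀ a, ∃ C, ∀ x ∈ interior (S a).closedInterior, ‖fderiv ℝ g x‖ ≤ C := fun a => by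
    obtain ⟨G, hG, hgG⟩ := hg.piece a
    have hc : ContinuousOn (fderiv ℝ G) (S a).closedInterior := fun x hx =>
      (((hG x hx).fderiv_right (m := 0) (by simp)).continuousAt).continuousWithinAt
    obtain ⟨C, hC⟩ := (S a).isCompact_closedInterior.exists_bound_of_continuousOn hc
    refine ⟨C, fun x hx => ?_⟩
    rw [(Filter.eventuallyEq_of_mem (mem_interior_iff_mem_nhds.1 hx) hgG).fderiv_eq]
    exact hC x (interior_subset hx)
  choose C hC using h
  obtain ⟨M, hM⟩ := Finite.exists_le C
  refine ⟨M, fun x hx hS => ?_⟩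
  obtain ⟨a, ha⟩ := hS.exists_mem_interior hg.cover hx
  exact (hC a x ha).trans (hM a)

theorem integrableOn_fderiv [Finite σ] (hg : PiecewiseC1 K S g) (w : Space d) :
    IntegrableOn (fun x => fderiv ℝ g x w) K.closedInterior := by
  obtain ⟨C, hC⟩ := hg.exists_bound
  refine Measure.integrableOn_of_bounded (M := C * ‖w‖)
    K.isCompact_closedInterior.measure_lt_top.ne
    (measurable_fderiv_apply_const ℝ g w).aestronglyMeasurable ?_
  filter_upwards [ae_restrict_of_ae (ae_offFacets S),
    ae_restrict_mem K.isClosed_closedInterior.measurableSet] with x hx hK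
  exact (ContinuousLinearMap.le_opNorm _ _).trans
    (mul_le_mul_of_nonneg_right (hC x hK hx) (norm_nonneg _))

end PiecewiseC1

theorem chart_hasDerivAt (K : Affine.Simplex ℝ (Space d) d) (a b : Fin (d + 1))
    (y : EuclideanSpace ℝ (OtherIdx a b)) (s : ℝ) :
    HasDerivAt (fun s => chart K a b (y, s)) (K.points a - K.points b) s := by
  simp only [chart, chartLin_apply]
  have h := ((hasDerivAt_id s).smul_const (K.points a - K.points b)).const_add
    (facetMap K a b b y)
  simpa using h.const_add (K.points b)

/-- An affine function whose zero set on a line is a null set has at most one zero on it. -/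
theorem subsingleton_zeros_chart (K : Affine.Simplex ℝ (Space d) d) (a b : Fin (d + 1))
    (f : Space d →ᵃ[ℝ] ℝ) (y : EuclideanSpace ℝ (OtherIdx a b))
    (h : ∀ᵐ s : ℝ, f (chart K a b (y, s)) ≠ 0) :
    {s : ℝ | f (chart K a b (y, s)) = 0}.Subsingleton := by
  have hlin : ∀ s : ℝ, f (chart K a b (y, s)) =
      f (chart K a b (y, 0)) + s * f.linear (K.points a - K.points b) := fun s => by
    have : chart K a b (y, s) = s • (K.points a - K.points b) +ᵥ chart K a b (y, 0) := by
      simp only [chart, chartLin_apply, vadd_eq_add]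
      rw [zero_smul]; abel
    rw [this, f.map_vadd, map_smul, vadd_eq_add, smul_eq_mul, add_comm]
  intro s hs r hr
  by_contra hne
  simp only [mem_ofPred_eq] at hs hr
  rw [hlin] at hs hr
  have h1 : (s - r) * f.linear (K.points a - K.points b) = 0 := by linarith
  have h2 := (mul_eq_zero.1 h1).resolve_left (sub_ne_zero.2 hne)
  rw [h2, mul_zero, add_zero] at hs
  obtain ⟨τ, hτ⟩ := h.exists
  exact hτ (by rw [hlin, h2, hs]; simp)

variable [NeZero d]

theorem chartJac_ne_zero (K : Affine.Simplex ℝ (Space d) d) {a b : Fin (d + 1)} (hab : a ≠ b) :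
    chartJac K hab ≠ 0 := by
  intro h0
  have h := volume_eq_map_chart K hab
  rw [h0] at h
  exact (NeZero.ne (volume : Measure (Space d))) (by simpa using h)

theorem ae_ae_chart (K : Affine.Simplex ℝ (Space d) d) {a b : Fin (d + 1)} (hab : a ≠ b)
    {P : Space d → Prop} (hP : ∀ᵐ x, P x) :
    ∀ᵐ y : EuclideanSpace ℝ (OtherIdx a b), ∀ᵐ s : ℝ, P (chart K a b (y, s)) := by
  rw [volume_eq_map_chart K hab, Measure.ae_ennreal_smul_measure_iff
    (by simpa using chartJac_ne_zero K hab)] at hP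
  have := ae_of_ae_map (measurableEmbedding_chart K hab).measurable.aemeasurable hP
  rw [Measure.volume_eq_prod] at this
  exact Measure.ae_ae_of_ae_prod this

theorem mem_closedInterior_chart_iff (K : Affine.Simplex ℝ (Space d) d) {a b : Fin (d + 1)}
    (hab : a ≠ b) (y : EuclideanSpace ℝ (OtherIdx a b)) (s : ℝ) :
    chart K a b (y, s) ∈ K.closedInterior ↔
      y ∈ refSimplex a b ∧ s ∈ Icc 0 (1 - ∑ c, y c) := by
  rw [mem_closedInterior_iff, forall_bary_chart_iff K hab (fun r => 0 ≤ r)]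
  simp only [refSimplex, mem_ofPred_eq, mem_Icc]
  constructor
  · rintro ⟨h1, h2, h3⟩
    exact ⟨⟨h1, by linarith⟩, h2, by linarith⟩
  · rintro ⟨⟨h1, _⟩, h2, h3⟩
    exact ⟨h1, h2, by linarith⟩

/-- Fubini in the chart: over each point of the reference simplex the simplex `K` is a segment
parallel to the edge `a b`. -/
theorem integral_eq_integral_chart (K : Affine.Simplex ℝ (Space d) d) {a b : Fin (d + 1)}
    (hab : a ≠ b) {f : Space d → ℝ} (hf : IntegrableOn f K.closedInterior) :
    ∫ x in K.closedInterior, f x = chartJac K hab * ∫ y in refSimplex a b,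
      ∫ s in Icc 0 (1 - ∑ c, y c), f (chart K a b (y, s)) := by
  have he := measurableEmbedding_chart K hab
  have hK := K.isClosed_closedInterior.measurableSet
  have hint : Integrable (K.closedInterior.indicator f) := (integrable_indicator_iff hK).2 hf
  rw [← integral_indicator hK]
  rw [volume_eq_map_chart K hab] at hint
  rw [volume_eq_map_chart K hab, integral_smul_measure, he.integral_map]
  rw [integrable_smul_measure (by simpa using chartJac_ne_zero K hab) (by simp), he.integrable_map_iff,
    Measure.volume_eq_prod] at hint
  rw [Measure.volume_eq_prod]
  change _ • ∫ q, (K.closedInterior.indicator f ∘ chart K a b) q ∂_ = _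
  rw [integral_prod _ hint, smul_eq_mul, ENNReal.coe_toReal,
    ← integral_indicator measurableSet_refSimplex]
  congr 1
  refine integral_congr_ae (Filter.Eventually.of_forall fun y => ?_)
  simp only
  by_cases hy : y ∈ refSimplex a b
  · rw [indicator_of_mem hy, ← integral_indicator measurableSet_Icc]
    congr 1
    ext s
    rw [Function.comp_apply]
    by_cases hs : s ∈ Icc 0 (1 - ∑ c, y c)
    · rw [indicator_of_mem ((mem_closedInterior_chart_iff K hab y s).2 ⟨hy, hs⟩),
        indicator_of_mem hs]
    · rw [indicator_of_notMem (fun h => hs ((mem_closedInterior_chart_iff K hab y s).1 h).2),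
        indicator_of_notMem hs]
  · rw [indicator_of_notMem hy]
    refine integral_eq_zero_of_ae (Filter.Eventually.of_forall fun s => ?_)
    exact indicator_of_notMem (fun h => hy ((mem_closedInterior_chart_iff K hab y s).1 h).1) f

/-- Almost every line parallel to the edge meets the facet hyperplanes of the subdivision in
countably many points. The fundamental theorem of calculus allows such an exceptional set for a
continuous function. -/
theorem PiecewiseC1.integral_fderiv_line [Finite σ] (hg : PiecewiseC1 K S g) {a b : Fin (d + 1)}
    (hab : a ≠ b) : ∀ᵐ y : EuclideanSpace ℝ (OtherIdx a b), y ∈ refSimplex a b →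
      ∫ s in Icc 0 (1 - ∑ c, y c),
        fderiv ℝ g (chart K a b (y, s)) (K.points a - K.points b) =
      g (chart K a b (y, 1 - ∑ c, y c)) - g (chart K a b (y, 0)) := by
  obtain ⟨C, hC⟩ := hg.exists_bound
  filter_upwards [ae_ae_chart K hab (ae_offFacets S),
    ae_ae_chart K hab (ae_offFacets (fun _ : Unit => K))] with y hy hyK hmem
  set v := K.points a - K.points b with hv
  set e := 1 - ∑ c, y c with he
  have he0 : 0 ≤ e := hmem.2
  set bad : Set ℝ := {s | ¬ OffFacets S (chart K a b (y, s))} with hbad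
  -- For almost every `y` no facet hyperplane contains the line, so each of them is met at most
  -- once.
  have hcount : bad.Countable := by
    have : bad = ⋃ i, ⋃ k, {s | bary (S i) k (chart K a b (y, s)) = 0} := by
      ext s; simp [hbad, OffFacets]
    rw [this]
    refine countable_iUnion fun i => countable_iUnion fun k => ?_
    refine (subsingleton_zeros_chart K a b (bary (S i) k) y ?_).countable
    filter_upwards [hy] with s hs using hs i k
  have hline : Continuous fun s : ℝ => chart K a b (y, s) :=
    (continuous_chart K).comp (by fun_prop)
  have hcont : ContinuousOn (fun s => g (chart K a b (y, s))) (Icc 0 e) :=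
    hg.continuousOn.comp hline.continuousOn fun s hs =>
      (mem_closedInterior_chart_iff K hab y s).2 ⟨hmem, hs⟩
  have hder : ∀ s ∈ Ioo 0 e \ bad, HasDerivAt (fun s => g (chart K a b (y, s)))
      (fderiv ℝ g (chart K a b (y, s)) v) s := by
    rintro s ⟨hs, hsb⟩
    have hoff : OffFacets S (chart K a b (y, s)) := not_not.1 hsb
    exact (hg.differentiableAt hoff ((mem_closedInterior_chart_iff K hab y s).2
      ⟨hmem, Ioo_subset_Icc_self hs⟩)).hasFDerivAt.comp_hasDerivAt s (chart_hasDerivAt K a b y s)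
  have hint : IntegrableOn (fun s => fderiv ℝ g (chart K a b (y, s)) v) (Icc 0 e) := by
    refine Measure.integrableOn_of_bounded (M := C * ‖v‖) (by simp)
      ((measurable_fderiv_apply_const ℝ g v).comp hline.measurable).aestronglyMeasurable ?_
    filter_upwards [ae_restrict_of_ae hy, ae_restrict_mem measurableSet_Icc] with s hs hsI
    exact (ContinuousLinearMap.le_opNorm _ _).trans (mul_le_mul_of_nonneg_right
      (hC _ ((mem_closedInterior_chart_iff K hab y s).2 ⟨hmem, hsI⟩) hs) (norm_nonneg _))
  rw [integral_Icc_eq_integral_Ioc, ← intervalIntegral.integral_of_le he0]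
  exact integral_eq_of_hasDerivAt_off_countable_of_le _ _ he0 hcount hcont hder
    ((intervalIntegrable_iff_integrableOn_Icc_of_le he0).2 hint)

theorem PiecewiseC1.integrable_chart_end [Finite σ] (hg : PiecewiseC1 K S g) {a b : Fin (d + 1)}
    (hab : a ≠ b) (r : EuclideanSpace ℝ (OtherIdx a b) → ℝ) (hr : Continuous r)
    (hmem : ∀ y ∈ refSimplex a b, r y ∈ Icc 0 (1 - ∑ c, y c)) :
    IntegrableOn (fun y => g (chart K a b (y, r y))) (refSimplex a b) := by
  have hc : ContinuousOn (fun y => g (chart K a b (y, r y))) (refSimplex a b) :=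
    hg.continuousOn.comp ((continuous_chart K).comp (by fun_prop)).continuousOn fun y hy =>
      (mem_closedInterior_chart_iff K hab y _).2 ⟨hy, hmem y hy⟩
  exact hc.integrableOn_compact isCompact_refSimplex

/-- The segments parallel to the edge start on the facet opposite to `a` and end on the facet
opposite to `b`. Integrating the line identity over the reference simplex produces the two facet
integrals. -/
theorem PiecewiseC1.integral_fderiv_edge [Finite σ] (hg : PiecewiseC1 K S g) {a b : Fin (d + 1)}
    (hab : a ≠ b) :
    ∫ x in K.closedInterior, fderiv ℝ g x (K.points a - K.points b) =
      (K.height b * ∫ x in (K.faceOpposite b).closedInterior, g x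
        ∂(Measure.euclideanHausdorffMeasure (d - 1))) -
      K.height a * ∫ x in (K.faceOpposite a).closedInterior, g x
        ∂(Measure.euclideanHausdorffMeasure (d - 1)) := by
  rw [integral_eq_integral_chart K hab (hg.integrableOn_fderiv _),
    height_smul_integral_left K hab, height_smul_integral_right K hab, ← mul_sub,
    ← integral_sub (hg.integrable_chart_end hab (fun y => 1 - ∑ c, y c) (by fun_prop)
        fun y hy => ⟨hy.2, le_rfl⟩)
      (hg.integrable_chart_end hab (fun y => 0) (by fun_prop) fun y hy => ⟨le_rfl, hy.2⟩)]
  congr 1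
  refine setIntegral_congr_ae measurableSet_refSimplex ?_
  exact hg.integral_fderiv_line hab

theorem sum_eq_edge {a b : Fin (d + 1)} (hab : a ≠ b) (f : Fin (d + 1) → ℝ)
    (hf : ∀ k, k ≠ a → k ≠ b → f k = 0) : ∑ k, f k = f a + f b := by
  rw [sum_eq_edge_add hab, Finset.sum_eq_zero (s := (Finset.univ : Finset (OtherIdx a b)))
    fun c _ => hf c.1 c.2.1 c.2.2, add_zero]

/-- The divergence theorem on a simplex for piecewise continuously differentiable functions. -/
theorem PiecewiseC1.integral_fderiv [Finite σ] (hg : PiecewiseC1 K S g) (w : Space d) :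
    ∫ x in K.closedInterior, fderiv ℝ g x w =
      ∑ k, inner ℝ (outwardNormal K k) w * ∫ x in (K.faceOpposite k).closedInterior, g x
        ∂(Measure.euclideanHausdorffMeasure (d - 1)) := by
  -- Both sides are linear in `w` and the edges at vertex `0` span, so edge directions suffice.
  have hw : w ∈ Submodule.span ℝ (range fun i => K.points i -ᵥ K.points 0) := by
    rw [← vectorSpan_range_eq_span_range_vsub_right, ← direction_affineSpan,
      show affineSpan ℝ (range K.points) = ⊤ from (vertexBasis K).tot']
    simp
  induction hw using Submodule.span_induction with
  | mem w hw =>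
    obtain ⟨i, rfl⟩ := hw
    simp only [vsub_eq_sub]
    by_cases hi : i = 0
    · subst hi; simp
    -- Every facet opposite to a vertex off this edge contains the edge, so its normal contributes
    -- nothing. Only the facets opposite to the two endpoints remain.
    rw [hg.integral_fderiv_edge hi, sum_eq_edge hi, inner_outwardNormal_edge K hi,
      ← neg_sub (K.points 0), inner_neg_right, inner_outwardNormal_edge K (Ne.symm hi)]
    · ring
    · intro k h1 h2
      rw [inner_outwardNormal_of_ne K h1 h2, zero_mul]
  | zero => simp
  | add u w _ _ hu hw =>
    simp only [map_add, inner_add_right, add_mul, Finset.sum_add_distrib]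
    rw [integral_add (hg.integrableOn_fderiv u) (hg.integrableOn_fderiv w), hu, hw]
  | smul r u _ hu =>
    simp only [map_smul, inner_smul_right, smul_eq_mul, mul_assoc]
    rw [integral_const_mul, hu, Finset.mul_sum]

end Divergence

/-! ### Periodic tilings by simplices -/

theorem hasSum_congr_fun {β : Type*} {f g : β → ℝ} {a : ℝ} (h : ∀ q, f q = g q) :
    HasSum f a ↔ HasSum g a := by
  rw [funext h]

namespace MacroMesh

/-! ### The lattice of periods and the locally finite tiling -/

section Lattice

variable {d : ℕ} (M : MacroMesh d)

theorem repr_shift (m : Fin d → ℤ) (k : Fin d) : M.period.repr (M.shift m) k = m k := by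
  rw [shift]
  simp [map_sum, Finsupp.single_apply]

theorem shift_zero : M.shift 0 = 0 := by simp [shift]

theorem shift_add (m n : Fin d → ℤ) : M.shift (m + n) = M.shift m + M.shift n := by
  simp [shift, add_smul, Finset.sum_add_distrib]

/-- Lattice coordinates are continuous, hence bounded on a ball, and they are integers here. -/
theorem finite_shift_mem {B : Set (Space d)} (hB : Bornology.IsBounded B) :
    {m | M.shift m ∈ B}.Finite := by
  obtain ⟨R, hR⟩ := hB.exists_norm_le
  have hlin : ∀ k, Continuous fun x => M.period.repr x k := fun k =>
    ((M.period.coord k).continuous_of_finiteDimensional)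
  have hbd : ∀ k, ∃ C : ℤ, ∀ x ∈ Metric.closedBall (0 : Space d) R, |M.period.repr x k| ≤ C :=
    fun k => by
      obtain ⟨C, hC⟩ := (isCompact_closedBall (0 : Space d) R).exists_bound_of_continuousOn
        (hlin k).continuousOn
      exact ⟨⌈C⌉, fun x hx => (hC x hx).trans (Int.le_ceil C)⟩
  choose C hC using hbd
  refine (finite_Icc (fun k => -C k) C).subset fun m hm => ?_
  have h : ∀ k, |m k| ≤ C k := fun k => by
    have := hC k (M.shift m) (mem_closedBall_zero_iff.2 (hR _ hm))
    rw [repr_shift] at this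
    exact_mod_cast this
  exact ⟨fun k => (abs_le.1 (h k)).1, fun k => (abs_le.1 (h k)).2⟩

/-- The fundamental parallelepiped of the lattice of periods. -/
def parallelepiped : Set (Space d) := {x | ∀ k, M.period.repr x k ∈ Ico (0 : ℝ) 1}

theorem measurableSet_parallelepiped : MeasurableSet M.parallelepiped := by
  rw [parallelepiped, ofPred_forall]
  exact MeasurableSet.iInter fun k =>
    ((M.period.coord k).continuous_of_finiteDimensional).measurable measurableSet_Ico

theorem add_shift_mem_parallelepiped_iff (x : Space d) (m : Fin d → ℤ) :
    x + M.shift m ∈ M.parallelepiped ↔ m = fun k => -⌊M.period.repr x k⌋ := by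
  have h1 : ∀ k, M.period.repr (x + M.shift m) k = M.period.repr x k + m k := fun k => by
    rw [map_add, Finsupp.add_apply, repr_shift]
  simp only [parallelepiped, mem_ofPred_eq, h1, mem_Ico]
  constructor
  · intro h
    funext k
    have : ⌊M.period.repr x k⌋ = -m k := by
      rw [Int.floor_eq_iff]
      push_cast
      constructor <;> linarith [(h k).1, (h k).2]
    rw [this, neg_neg]
  · rintro rfl k
    push_cast
    constructor <;> linarith [Int.floor_le (M.period.repr x k), Int.lt_floor_add_one (M.period.repr x k)]

/-- Each orbit of the lattice meets the parallelepiped exactly once, so a single term survives. This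
unfolds an integral over one period into integrals over the facets of the representing cells. -/
theorem tsum_indicator_parallelepiped {φ : Space d → ENNReal}
    (hφ : ∀ x m, φ (x + M.shift m) = φ x) (x : Space d) :
    ∑' m, M.parallelepiped.indicator φ (x + M.shift m) = φ x := by
  rw [tsum_eq_single (fun k => -⌊M.period.repr x k⌋)]
  · rw [indicator_of_mem ((M.add_shift_mem_parallelepiped_iff x _).2 rfl), hφ]
  · intro m hm
    exact indicator_of_notMem (fun h => hm ((M.add_shift_mem_parallelepiped_iff x m).1 h)) _

/-- The translate `K_j + λ_m` for `q = (j, m)`. -/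
def cellShift (q : Fin M.N × (Fin d → ℤ)) : Set (Space d) :=
  (fun x => x + M.shift q.2) '' M.cell q.1

theorem mem_cellShift {q : Fin M.N × (Fin d → ℤ)} {x : Space d} :
    x ∈ M.cellShift q ↔ x - M.shift q.2 ∈ M.cell q.1 := by
  rw [cellShift, image_add_right, mem_preimage, sub_eq_add_neg]

theorem isCompact_cell (i : Fin M.N) : IsCompact (M.cell i) :=
  (M.elem i).isCompact_closedInterior

theorem isClosed_cellShift (q : Fin M.N × (Fin d → ℤ)) : IsClosed (M.cellShift q) :=
  ((M.isCompact_cell q.1).image (continuous_add_const _)).isClosed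

theorem cell_eq_cellShift (i : Fin M.N) : M.cell i = M.cellShift (i, 0) := by
  ext x; rw [mem_cellShift]; simp [shift_zero]

theorem exists_mem_cellShift (x : Space d) : ∃ q, x ∈ M.cellShift q := by
  obtain ⟨i, m, h⟩ := M.cover x
  exact ⟨(i, m), M.mem_cellShift.2 h⟩

-- If `K_j + λ_m` meets `B`, then `λ_m` lies in the bounded set `B - K_j`.
open scoped Pointwise in
theorem finite_cellShift_inter {B : Set (Space d)} (hB : Bornology.IsBounded B) :
    {q | (M.cellShift q ∩ B).Nonempty}.Finite := by
  have h : ∀ j, {m | M.shift m ∈ B - M.cell j}.Finite := fun j =>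
    M.finite_shift_mem (hB.sub (M.isCompact_cell j).isBounded)
  refine (finite_iUnion fun j => (finite_singleton j).prod (h j)).subset ?_
  intro q hq
  obtain ⟨x, hx, hxB⟩ := hq
  rw [mem_cellShift] at hx
  have hq2 : M.shift q.2 ∈ B - M.cell q.1 := by
    have := sub_mem_sub hxB hx
    rwa [sub_sub_cancel] at this
  exact mem_iUnion.2 ⟨q.1, mk_mem_prod (mem_singleton _) hq2⟩

theorem locallyFinite_cellShift : LocallyFinite M.cellShift := fun x =>
  ⟨Metric.ball x 1, Metric.ball_mem_nhds x one_pos, M.finite_cellShift_inter Metric.isBounded_ball⟩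

/-- The mesh axiom compares an untranslated cell with a translate. Shifting both cells by `λ_m`
reduces two arbitrary translates to that case. -/
theorem interior_cellShift_inter (q r : Fin M.N × (Fin d → ℤ)) (h : q ≠ r) :
    Disjoint (interior (M.cellShift q)) (interior (M.cellShift r)) := by
  obtain ⟨i, m⟩ := q
  obtain ⟨j, n⟩ := r
  have hne : (j, n - m) ≠ (i, 0) := by
    rintro h'
    obtain ⟨rfl, h2⟩ := Prod.mk.inj h'
    exact h (by rw [sub_eq_zero.1 h2])
  have key := M.disjoint i j (n - m) hne
  have e1 : M.cellShift (i, m) = (Homeomorph.addRight (M.shift m)) '' M.cell i := rfl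
  have e2 : M.cellShift (j, n) = (Homeomorph.addRight (M.shift m)) ''
      ((fun x => x + M.shift (n - m)) '' M.cell j) := by
    rw [image_image, cellShift]
    refine image_congr fun x _ => ?_
    change x + M.shift n = x + M.shift (n - m) + M.shift m
    rw [add_assoc, ← shift_add, sub_add_cancel]
  rw [e1, e2, ← Homeomorph.image_interior, ← Homeomorph.image_interior]
  exact disjoint_image_of_injective (Homeomorph.injective _) key

theorem convex_cellShift (q : Fin M.N × (Fin d → ℤ)) : Convex ℝ (M.cellShift q) := by
  have h := (convex_closedInterior (M.elem q.1)).translate (M.shift q.2)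
  have e : M.cellShift q = (fun x => M.shift q.2 + x) '' (M.elem q.1).closedInterior := by
    ext x
    rw [mem_cellShift, image_add_left, mem_preimage, neg_add_eq_sub]
    rfl
  rw [e]
  exact h

/-- A common point cannot be interior to both cells, so it lies on the boundary of one of two convex
sets, and such boundaries are null. -/
theorem aedisjoint_cellShift :
    Pairwise (Function.onFun (AEDisjoint (volume : Measure (Space d))) M.cellShift) := by
  intro q r h
  refine measure_mono_null (t := frontier (M.cellShift q) ∪ frontier (M.cellShift r)) ?_ ?_
  · rintro x ⟨hq, hr⟩
    by_contra hx
    rw [mem_union, not_or, (M.isClosed_cellShift q).frontier_eq,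
      (M.isClosed_cellShift r).frontier_eq] at hx
    exact (disjoint_left.1 (M.interior_cellShift_inter q r h))
      (by_contra fun h' => hx.1 ⟨hq, h'⟩) (by_contra fun h' => hx.2 ⟨hr, h'⟩)
  · exact measure_union_null ((M.convex_cellShift q).addHaar_frontier _)
      ((M.convex_cellShift r).addHaar_frontier _)

theorem closure_interior_cell (i : Fin M.N) : closure (interior (M.cell i)) = M.cell i := by
  have hne : (interior (M.cell i)).Nonempty := by
    rw [cell, ← (M.elem i).convexHull_eq_closedInterior]
    exact interior_convexHull_nonempty_iff_affineSpan_eq_top.2 (vertexBasis (M.elem i)).tot'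
  change closure (interior (M.elem i).closedInterior) = _
  rw [(convex_closedInterior (M.elem i)).closure_interior_eq_closure_of_nonempty_interior hne]
  exact (M.isCompact_cell i).isClosed.closure_eq

/-- Every boundary point of a macro-element lies on the boundary of a different one. -/
theorem exists_mem_interface {i : Fin M.N} {x : Space d} (hx : x ∈ frontier (M.cell i)) :
    ∃ j m, (j, m) ≠ (i, 0) ∧ x ∈ M.interface i j m := by
  -- By local finiteness the other cells have a closed union. It contains the complement of `K_i`,
  -- hence every boundary point of `K_i`.
  have hclosed : IsClosed (⋃ q : {q // q ≠ (i, (0 : Fin d → ℤ))}, M.cellShift q) :=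
    (M.locallyFinite_cellShift.comp_injective Subtype.val_injective).isClosed_iUnion
      fun q => M.isClosed_cellShift q
  have hsub : (M.cell i)ᶜ ⊆ ⋃ q : {q // q ≠ (i, (0 : Fin d → ℤ))}, M.cellShift q := by
    intro y hy
    obtain ⟨q, hq⟩ := M.exists_mem_cellShift y
    refine mem_iUnion.2 ⟨⟨q, ?_⟩, hq⟩
    rintro rfl
    exact hy (by rwa [cell_eq_cellShift])
  have hxT := hclosed.closure_subset_iff.2 hsub
    (frontier_subset_closure (by rwa [frontier_compl]) : x ∈ closure (M.cell i)ᶜ)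
  obtain ⟨⟨⟨j, m⟩, hne⟩, hq⟩ := mem_iUnion.1 hxT
  refine ⟨j, m, hne, hx, ?_⟩
  change x ∈ frontier (M.cellShift (j, m))
  rw [(M.isClosed_cellShift _).frontier_eq]
  refine ⟨hq, fun hint => ?_⟩
  -- If `x` were interior to the other cell, interior points of `K_i` close to `x` would be interior
  -- to both.
  have hxc : x ∈ closure (interior (M.cell i)) := by
    rw [closure_interior_cell]
    exact (M.isCompact_cell i).isClosed.frontier_subset hx
  obtain ⟨y, hy1, hy2⟩ := mem_closure_iff.1 hxc _ isOpen_interior hint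
  exact disjoint_left.1 (M.interior_cellShift_inter _ _ hne) hy1 (by rwa [← cell_eq_cellShift])

end Lattice

/-! ### Cancellation of normals across a possibly nonconforming skeleton -/

section Cancellation

variable {d : ℕ} [NeZero d] (M : MacroMesh d)

/-- The `l`-th facet of the `j`-th macro-element. -/
def facet (j : Fin M.N) (l : Fin (d + 1)) : Set (Space d) :=
  ((M.elem j).faceOpposite l).closedInterior

/-- The surface measure of a facet. -/
def facetMeasure (j : Fin M.N) (l : Fin (d + 1)) : Measure (Space d) :=
  (Measure.euclideanHausdorffMeasure (d - 1)).restrict (M.facet j l)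

instance (j : Fin M.N) (l : Fin (d + 1)) : IsFiniteMeasure (M.facetMeasure j l) := by
  refine ⟨?_⟩
  rw [facetMeasure, Measure.restrict_apply_univ]
  exact facet_measure_lt_top _ _

theorem facet_subset_cell (j : Fin M.N) (l : Fin (d + 1)) : M.facet j l ⊆ M.cell j :=
  (M.elem j).closedInterior_faceOpposite_subset_closedInterior l

theorem measurableSet_facet (j : Fin M.N) (l : Fin (d + 1)) : MeasurableSet (M.facet j l) :=
  ((M.elem j).faceOpposite l).isClosed_closedInterior.measurableSet

/-- The sum over all translated facets of the surface measure with periodic weights `c`. -/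
def skeletonMeasure (c : Fin M.N → Fin (d + 1) → ENNReal) : Measure (Space d) :=
  Measure.sum fun q : (Fin M.N × (Fin d → ℤ)) × Fin (d + 1) =>
    c q.1.1 q.2 • (M.facetMeasure q.1.1 q.2).map fun x => x + M.shift q.1.2

variable {M} in
theorem skeletonMeasure_lt_top {c : Fin M.N → Fin (d + 1) → ENNReal} (hc : ∀ j l, c j l ≠ ⊤)
    {B : Set (Space d)} (hB : Bornology.IsBounded B) : M.skeletonMeasure c B < ⊤ := by
  refine (measure_mono subset_closure).trans_lt ?_
  have hm : MeasurableSet (closure B) := isClosed_closure.measurableSet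
  have hfin := (M.finite_cellShift_inter hB.closure).prod (finite_univ (α := Fin (d + 1)))
  rw [skeletonMeasure, Measure.sum_apply _ hm, tsum_eq_sum (s := hfin.toFinset)]
  · refine ENNReal.sum_lt_top.2 fun q _ => ?_
    rw [Measure.smul_apply, Measure.map_apply (measurable_add_const _) hm, smul_eq_mul]
    exact ENNReal.mul_lt_top (hc _ _).lt_top (measure_lt_top _ _)
  · intro q hq
    rw [Measure.smul_apply, Measure.map_apply (measurable_add_const _) hm, facetMeasure,
      Measure.restrict_apply (measurable_add_const _ hm), smul_eq_mul]
    have : (fun x => x + M.shift q.1.2) ⁻¹' closure B ∩ M.facet q.1.1 q.2 = ∅ := by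
      rw [eq_empty_iff_forall_notMem]
      rintro x ⟨hx1, hx2⟩
      refine hq ((Set.Finite.mem_toFinset _).2 ⟨⟨x + M.shift q.1.2, ?_, hx1⟩, trivial⟩)
      exact ⟨x, M.facet_subset_cell _ _ hx2, rfl⟩
    rw [this, measure_empty, mul_zero]

/-- Summing over translated facets inside one period is, by periodicity, the same as summing over
all translates of the period along each original facet. -/
theorem lintegral_skeletonMeasure (c : Fin M.N → Fin (d + 1) → ENNReal) {φ : Space d → ENNReal}
    (hφ : ∀ x m, φ (x + M.shift m) = φ x) (hm : ∀ j l, AEMeasurable φ (M.facetMeasure j l)) :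
    ∫⁻ x in M.parallelepiped, φ x ∂M.skeletonMeasure c =
      ∑ j, ∑ l, c j l * ∫⁻ x, φ x ∂M.facetMeasure j l := by
  have hP := M.measurableSet_parallelepiped
  have hind : ∀ j l (m : Fin d → ℤ),
      AEMeasurable (fun x => M.parallelepiped.indicator φ (x + M.shift m))
        (M.facetMeasure j l) := fun j l m => by
    -- Periodicity removes the shift from `φ`, so measurability is needed on the untranslated facet
    -- only.
    have : (fun x => M.parallelepiped.indicator φ (x + M.shift m)) =
        ((fun x => x + M.shift m) ⁻¹' M.parallelepiped).indicator φ := by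
      ext x
      by_cases h : x + M.shift m ∈ M.parallelepiped
      · rw [indicator_of_mem h, indicator_of_mem (by exact h), hφ]
      · rw [indicator_of_notMem h, indicator_of_notMem (by exact h)]
    rw [this]
    exact (hm j l).indicator (measurable_add_const _ hP)
  rw [← lintegral_indicator hP, skeletonMeasure, lintegral_sum_measure, ENNReal.tsum_prod',
    ENNReal.tsum_prod', tsum_fintype]
  refine Finset.sum_congr rfl fun j _ => ?_
  rw [ENNReal.tsum_comm, tsum_fintype]
  refine Finset.sum_congr rfl fun l _ => ?_
  simp_rw [lintegral_smul_measure,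
    (measurableEmbedding_addRight (M.shift _)).lintegral_map, smul_eq_mul]
  rw [ENNReal.tsum_mul_left, ← lintegral_tsum (hind j l)]
  simp_rw [M.tsum_indicator_parallelepiped hφ]

theorem piecewiseC1_of_contDiff {K : Affine.Simplex ℝ (Space d) d} {g : Space d → ℝ}
    (hg : ContDiff ℝ 1 g) : PiecewiseC1 K (fun _ : Unit => K) g where
  cover := iUnion_const _
  continuousOn := hg.continuous.continuousOn
  piece _ := ⟨g, fun _ _ => hg.contDiffAt, fun _ _ => rfl⟩

theorem integral_fderiv_eq_zero {g : Space d → ℝ} (hg : ContDiff ℝ 1 g)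
    (hs : HasCompactSupport g) (w : Space d) : ∫ x, fderiv ℝ g x w = 0 := by
  have hi : Integrable fun x => fderiv ℝ g x w :=
    ((hg.continuous_fderiv one_ne_zero).clm_apply continuous_const).integrable_of_hasCompactSupport
      (hs.fderiv_apply (𝕜 := ℝ) w)
  have := integral_mul_fderiv_eq_neg_fderiv_mul_of_integrable (μ := (volume : Measure (Space d)))
    (f := fun _ : Space d => (1 : ℝ)) (g := g) (v := w) (by simp) (by simpa using hi)
    (by simpa using hg.continuous.integrable_of_hasCompactSupport hs)
    (fun _ _ => differentiableAt_const _)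
    (fun x _ => hg.contDiffAt.differentiableAt one_ne_zero)
  simpa using this

/-- The integral of a directional derivative of `g` over all of space is zero. Splitting it over the
tiling and applying the divergence theorem in each cell says that the skeleton weighted by `n · w`
annihilates test functions. -/
theorem hasSum_facets {g : Space d → ℝ} (hg : ContDiff ℝ 1 g) (hs : HasCompactSupport g)
    (w : Space d) : HasSum (fun q : Fin M.N × (Fin d → ℤ) => ∑ l,
      inner ℝ (outwardNormal (M.elem q.1) l) w *
        ∫ x, g (x + M.shift q.2) ∂M.facetMeasure q.1 l) 0 := by
  have hi : Integrable fun x => fderiv ℝ g x w :=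
    ((hg.continuous_fderiv one_ne_zero).clm_apply continuous_const).integrable_of_hasCompactSupport
      (hs.fderiv_apply (𝕜 := ℝ) w)
  have h := hasSum_integral_iUnion_ae (f := fun x => fderiv ℝ g x w)
    (fun q => (M.isClosed_cellShift q).measurableSet.nullMeasurableSet)
    M.aedisjoint_cellShift hi.integrableOn
  have hU : ⋃ q, M.cellShift q = univ :=
    eq_univ_of_forall fun x => mem_iUnion.2 (M.exists_mem_cellShift x)
  rw [hU, setIntegral_univ, integral_fderiv_eq_zero hg hs] at h
  refine (hasSum_congr_fun fun q => ?_).1 h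
  change ∫ x in (fun x => x + M.shift q.2) '' M.cell q.1, _ = _
  rw [(measurePreserving_add_right volume (M.shift q.2)).setIntegral_image_emb
    (measurableEmbedding_addRight _)]
  have hg' : ContDiff ℝ 1 fun x => g (x + M.shift q.2) := hg.comp (contDiff_id.add contDiff_const)
  have := (piecewiseC1_of_contDiff (K := M.elem q.1) hg').integral_fderiv w
  simp_rw [fderiv_comp_add_right] at this
  exact this

theorem isLocallyFiniteMeasure_skeletonMeasure {c : Fin M.N → Fin (d + 1) → ENNReal}
    (hc : ∀ j l, c j l ≠ ⊤) : IsLocallyFiniteMeasure (M.skeletonMeasure c) :=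
  ⟨fun x => ⟨Metric.ball x 1, Metric.ball_mem_nhds x one_pos,
    skeletonMeasure_lt_top hc Metric.isBounded_ball⟩⟩

theorem hasSum_integral_skeletonMeasure {c : Fin M.N → Fin (d + 1) → ENNReal}
    (hc : ∀ j l, c j l ≠ ⊤) {g : Space d → ℝ} (hg : Continuous g) (hs : HasCompactSupport g) :
    HasSum (fun q : Fin M.N × (Fin d → ℤ) => ∑ l, (c q.1 l).toReal *
        ∫ x, g (x + M.shift q.2) ∂M.facetMeasure q.1 l) (∫ x, g x ∂M.skeletonMeasure c) := by
  have := M.isLocallyFiniteMeasure_skeletonMeasure hc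
  have hi : Integrable g (M.skeletonMeasure c) := hg.integrable_of_hasCompactSupport hs
  rw [skeletonMeasure] at hi ⊢
  have h := HasSum.prod_fiberwise (hasSum_integral_measure hi) fun q => hasSum_fintype _
  refine (hasSum_congr_fun fun q => ?_).1 h
  refine Finset.sum_congr rfl fun l _ => ?_
  rw [integral_smul_measure, (measurableEmbedding_addRight (M.shift q.2)).integral_map,
    smul_eq_mul]

/-- The normals of the facets cancel across the skeleton. -/
theorem skeletonMeasure_eq (w : Space d) :
    M.skeletonMeasure (fun j l => ENNReal.ofReal (inner ℝ (outwardNormal (M.elem j) l) w)) =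
    M.skeletonMeasure (fun j l => ENNReal.ofReal (-inner ℝ (outwardNormal (M.elem j) l) w)) := by
  set c : Fin M.N → Fin (d + 1) → ℝ := fun j l => inner ℝ (outwardNormal (M.elem j) l) w with hc
  set μ := M.skeletonMeasure fun j l => ENNReal.ofReal (c j l) with hμ
  set ν := M.skeletonMeasure fun j l => ENNReal.ofReal (-c j l) with hν
  have hμf : IsLocallyFiniteMeasure μ := M.isLocallyFiniteMeasure_skeletonMeasure fun _ _ => by simp
  have hνf : IsLocallyFiniteMeasure ν := M.isLocallyFiniteMeasure_skeletonMeasure fun _ _ => by simp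
  have key : ∀ g : Space d → ℝ, ContDiff ℝ 1 g → HasCompactSupport g →
      ∫ x, g x ∂μ = ∫ x, g x ∂ν := by
    intro g hg hs
    have h1 := M.hasSum_integral_skeletonMeasure (c := fun j l => ENNReal.ofReal (c j l))
      (fun _ _ => by simp) hg.continuous hs
    have h2 := M.hasSum_integral_skeletonMeasure (c := fun j l => ENNReal.ofReal (-c j l))
      (fun _ _ => by simp) hg.continuous hs
    have h3 := (h1.sub h2).unique (a₂ := 0) (by
      refine (hasSum_congr_fun fun q => ?_).2 (M.hasSum_facets hg hs w)
      rw [← Finset.sum_sub_distrib]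
      refine Finset.sum_congr rfl fun l _ => ?_
      -- The signed weight is the difference of its positive and negative parts, which are the
      -- weights of `μ` and `ν`.
      rw [← sub_mul, ENNReal.toReal_ofReal', ENNReal.toReal_ofReal', max_zero_sub_max_neg_zero_eq_self])
    exact sub_eq_zero.1 h3
  -- It suffices to compare bounded open sets. With `f` smooth, positive exactly on `U` and at most
  -- `1`, the test functions `1 - (1 - f) ^ n` tend pointwise to the indicator of `U`.
  refine Measure.OuterRegular.ext_isOpen_isBounded fun U hU hUb => ?_
  obtain ⟨f, hfs, hf, hfr⟩ := hU.exists_contDiff_support_eq (n := 1)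
  have hf01 : ∀ x, 0 ≤ f x ∧ f x ≤ 1 := fun x => hfr (mem_range_self x)
  have hfsupp : ∀ n : ℕ, HasCompactSupport fun x => 1 - (1 - f x) ^ n := fun n => by
    refine HasCompactSupport.of_support_subset_isCompact (K := closure U)
      (hUb.isCompact_closure) fun x hx => subset_closure ?_
    rw [← hfs]
    intro h0
    exact hx (by simp [h0])
  have hlim : ∀ ρ : Measure (Space d), IsLocallyFiniteMeasure ρ →
      Filter.Tendsto (fun n : ℕ => ∫ x, (1 - (1 - f x) ^ n) ∂ρ) Filter.atTop
        (nhds (ρ.real U)) := by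
    intro ρ hρ
    have hUfin : ρ U < ⊤ := hUb.measure_lt_top
    rw [← integral_indicator_one hU.measurableSet]
    refine tendsto_integral_of_dominated_convergence (U.indicator 1)
      (fun n => (by fun_prop : Continuous fun x => 1 - (1 - f x) ^ n).aestronglyMeasurable)
      ((integrable_indicator_iff hU.measurableSet).2 (integrableOn_const hUfin.ne))
      (fun n => Filter.Eventually.of_forall fun x => ?_)
      (Filter.Eventually.of_forall fun x => ?_)
    · by_cases hx : x ∈ U
      · rw [indicator_of_mem hx, Pi.one_apply, Real.norm_eq_abs, abs_le]
        have h1 := pow_nonneg (sub_nonneg.2 (hf01 x).2) n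
        have h2 := pow_le_one₀ (n := n) (sub_nonneg.2 (hf01 x).2) (by linarith [(hf01 x).1])
        constructor <;> linarith
      · have h0 : f x = 0 := by rwa [← hfs, Function.notMem_support] at hx
        simp [h0, indicator_of_notMem hx]
    · by_cases hx : x ∈ U
      · rw [indicator_of_mem hx, Pi.one_apply]
        have h0 : f x ≠ 0 := by rwa [← hfs] at hx
        have hpos : 0 < f x := lt_of_le_of_ne (hf01 x).1 h0.symm
        have := tendsto_pow_atTop_nhds_zero_of_lt_one (sub_nonneg.2 (hf01 x).2)
          (by linarith : 1 - f x < 1)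
        simpa using this.const_sub 1
      · have h0 : f x = 0 := by rwa [← hfs, Function.notMem_support] at hx
        simp [h0, indicator_of_notMem hx]
  have heq := tendsto_nhds_unique (hlim μ hμf) ((hlim ν hνf).congr fun n =>
    (key _ (by have := hf; fun_prop) (hfsupp n)).symm)
  exact (measureReal_eq_measureReal_iff hUb.measure_lt_top.ne hUb.measure_lt_top.ne).1 heq

/-- Integrals of a single-valued periodic function over the boundaries of all macro-elements
cancel when weighted with the outward normals. -/
theorem sum_inner_normal_mul_integral_eq_zero (w : Space d) {G : Space d → ℝ}
    (hG : ∀ x m, G (x + M.shift m) = G x) (hi : ∀ j l, Integrable G (M.facetMeasure j l)) :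
    ∑ j, ∑ l, inner ℝ (outwardNormal (M.elem j) l) w * ∫ x, G x ∂M.facetMeasure j l = 0 := by
  -- The measure identity speaks of nonnegative functions, so the positive parts of `G` and of `-G`
  -- are treated separately.
  have key : ∀ F : Space d → ℝ, (∀ x m, F (x + M.shift m) = F x) →
      (∀ j l, Integrable F (M.facetMeasure j l)) →
      ∑ j, ∑ l, inner ℝ (outwardNormal (M.elem j) l) w *
        (∫⁻ x, ENNReal.ofReal (F x) ∂M.facetMeasure j l).toReal = 0 := by
    intro F hF hFi
    have hφ : ∀ x m, ENNReal.ofReal (F (x + M.shift m)) = ENNReal.ofReal (F x) :=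
      fun x m => by rw [hF]
    have hm : ∀ j l, AEMeasurable (fun x => ENNReal.ofReal (F x)) (M.facetMeasure j l) :=
      fun j l => (hFi j l).aemeasurable.ennreal_ofReal
    have hfin : ∀ j l, ∫⁻ x, ENNReal.ofReal (F x) ∂M.facetMeasure j l ≠ ⊤ := fun j l =>
      ((lintegral_mono fun x => Real.ofReal_le_enorm _).trans_lt (hFi j l).2).ne
    have h1 := M.lintegral_skeletonMeasure
      (fun j l => ENNReal.ofReal (inner ℝ (outwardNormal (M.elem j) l) w)) hφ hm
    have h2 := M.lintegral_skeletonMeasure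
      (fun j l => ENNReal.ofReal (-inner ℝ (outwardNormal (M.elem j) l) w)) hφ hm
    rw [skeletonMeasure_eq, h2] at h1
    have h3 := congrArg ENNReal.toReal h1
    have hne : ∀ (c : ℝ) j l,
        ENNReal.ofReal c * ∫⁻ x, ENNReal.ofReal (F x) ∂M.facetMeasure j l ≠ ⊤ :=
      fun c j l => ENNReal.mul_ne_top ENNReal.ofReal_ne_top (hfin j l)
    rw [ENNReal.toReal_sum fun j _ => ENNReal.sum_ne_top.2 fun l _ => hne _ j l,
      ENNReal.toReal_sum fun j _ => ENNReal.sum_ne_top.2 fun l _ => hne _ j l] at h3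
    simp_rw [ENNReal.toReal_sum fun l _ => hne _ _ l, ENNReal.toReal_mul,
      ENNReal.toReal_ofReal'] at h3
    rw [eq_comm, ← sub_eq_zero, ← Finset.sum_sub_distrib] at h3
    rw [← h3]
    refine Finset.sum_congr rfl fun j _ => ?_
    rw [← Finset.sum_sub_distrib]
    refine Finset.sum_congr rfl fun l _ => ?_
    rw [← sub_mul, max_zero_sub_max_neg_zero_eq_self]
  have h1 := key G hG hi
  have h2 := key (fun x => -G x) (fun x m => by rw [hG]) fun j l => (hi j l).neg
  rw [← sub_zero (0 : ℝ)]
  nth_rewrite 1 [← h1]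
  rw [← h2, ← Finset.sum_sub_distrib]
  refine Finset.sum_congr rfl fun j _ => ?_
  rw [← Finset.sum_sub_distrib]
  refine Finset.sum_congr rfl fun l _ => ?_
  rw [integral_eq_lintegral_pos_part_sub_lintegral_neg_part (hi j l), mul_sub]

end Cancellation

end MacroMesh

/-! ### Entropy variables -/

section Euler

variable {d : ℕ} {γ : ℝ}

theorem sum_state (f : Fin (d + 2) → ℝ) :
    ∑ k, f k = f 0 + ∑ i : Fin d, f (momIdx i) + f (enIdx d) := by
  rw [Fin.sum_univ_succ, Fin.sum_univ_castSucc, ← add_assoc]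
  rfl

theorem dotProduct_state (a b : State d) :
    a ⬝ᵥ b = a 0 * b 0 + ∑ i : Fin d, a (momIdx i) * b (momIdx i) +
      a (enIdx d) * b (enIdx d) :=
  sum_state _

theorem velocity_consVars (v : State d) (i : Fin d) :
    velocity (consVars γ v) i = v (momIdx i) / -v (enIdx d) := by
  rw [consVars, velocity_mk (Real.exp_ne_zero _)]

theorem density_pos_consVars (v : State d) : 0 < density (consVars γ v) := Real.exp_pos _

theorem consVars_mom (v : State d) (i : Fin d) :
    consVars γ v (momIdx i) = density (consVars γ v) * velocity (consVars γ v) i := by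
  rw [velocity]
  field_simp [(density_pos_consVars (γ := γ) v).ne']

theorem pressure_consVars (hγ : 1 < γ) (v : State d) :
    pressure γ (consVars γ v) = density (consVars γ v) / -v (enIdx d) := by
  conv_lhs => rw [consVars, pressure_mk hγ (Real.exp_ne_zero _)]
  rfl

theorem consVars_en (v : State d) :
    consVars γ v (enIdx d) = density (consVars γ v) / -v (enIdx d) / (γ - 1) +
      density (consVars γ v) * (velocity (consVars γ v) ⬝ᵥ velocity (consVars γ v)) / 2 := by
  have h : velocity (consVars γ v) = fun i => v (momIdx i) / -v (enIdx d) :=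
    funext (velocity_consVars v)
  rw [h]
  conv_lhs => rw [consVars, mkState_en]
  rfl

theorem beta_consVars (hγ : 1 < γ) {v : State d} (hv : Admissible v) :
    beta γ (consVars γ v) = -v (enIdx d) := by
  have h1 := density_pos_consVars (γ := γ) v
  have h2 : v (enIdx d) ≠ 0 := ne_of_lt hv
  rw [beta, pressure_consVars hγ]
  field_simp

/-- This closed form in the components of `v` is the source of all later derivatives and smoothness
statements. -/
theorem density_consVars (hγ : 1 < γ) {v : State d} (hv : Admissible v) :
    density (consVars γ v) = Real.exp (v 0 + (∑ i, v (momIdx i) ^ 2) / (2 * -v (enIdx d)) -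
      (γ + Real.log (-v (enIdx d))) / (γ - 1)) := by
  have h2 : v (enIdx d) ≠ 0 := ne_of_lt hv
  have h3 : γ - 1 ≠ 0 := by linarith
  conv_lhs => rw [consVars]
  simp only [density_mk]
  congr 1
  have : ((fun i => v (momIdx i) / -v (enIdx d)) ⬝ᵥ fun i => v (momIdx i) / -v (enIdx d)) =
      (∑ i, v (momIdx i) ^ 2) / v (enIdx d) ^ 2 := by
    rw [dotProduct, Finset.sum_div]
    refine Finset.sum_congr rfl fun i _ => ?_
    field_simp
  rw [this]
  field_simp
  ring

/-- The previous formula solved for `v 0`. A jump of `v 0` thereby becomes jumps of `log ρ`, `log β`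
and `β |V|²`. -/
theorem log_density_consVars (hγ : 1 < γ) {v : State d} (hv : Admissible v) :
    v 0 = Real.log (density (consVars γ v)) + (γ + Real.log (-v (enIdx d))) / (γ - 1) -
      -v (enIdx d) * (velocity (consVars γ v) ⬝ᵥ velocity (consVars γ v)) / 2 := by
  have h2 : v (enIdx d) ≠ 0 := ne_of_lt hv
  have : (velocity (consVars γ v) ⬝ᵥ velocity (consVars γ v)) =
      (∑ i, v (momIdx i) ^ 2) / v (enIdx d) ^ 2 := by
    rw [dotProduct, Finset.sum_div]
    refine Finset.sum_congr rfl fun i _ => ?_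
    rw [velocity_consVars]
    field_simp
  rw [this, density_consVars hγ hv, Real.log_exp]
  field_simp
  ring

/-- The entropy is the Legendre transform of the density as a function of the entropy variables. -/
theorem entropy_consVars (hγ : 1 < γ) {v : State d} (hv : Admissible v) :
    entropy γ (consVars γ v) = v ⬝ᵥ consVars γ v - density (consVars γ v) := by
  have hg : γ - 1 ≠ 0 := by linarith
  have hb : v (enIdx d) ≠ 0 := ne_of_lt hv
  have hbeta := beta_consVars hγ hv
  have h0 := congrFun (entropyVars_consVars hγ hv) 0
  rw [entropyVars, mkState_zero, hbeta] at h0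
  have hm : ∑ i, v (momIdx i) * consVars γ v (momIdx i) =
      -v (enIdx d) * density (consVars γ v) *
        (velocity (consVars γ v) ⬝ᵥ velocity (consVars γ v)) := by
    rw [dotProduct, Finset.mul_sum]
    refine Finset.sum_congr rfl fun i _ => ?_
    rw [consVars_mom, velocity_consVars]
    field_simp
  rw [dotProduct_state, hm, consVars_en, ← h0, entropy]
  change _ = _ * density (consVars γ v) + _ + _ - _
  field_simp
  ring

/-- The density is the potential dual to the entropy: its gradient in the entropy variables is `u`.
-/
theorem hasDerivWithinAt_density {c : ℝ → State d} {c' : State d} {s : Set ℝ} {t : ℝ}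
    (hγ : 1 < γ) (hc : ∀ k, HasDerivWithinAt (fun τ => c τ k) (c' k) s t)
    (hadm : ∀ τ ∈ s, Admissible (c τ)) (ht : t ∈ s) :
    HasDerivWithinAt (fun τ => density (consVars γ (c τ))) (consVars γ (c t) ⬝ᵥ c') s t := by
  have hg : γ - 1 ≠ 0 := by linarith
  have hb : c t (enIdx d) ≠ 0 := ne_of_lt (hadm t ht)
  have hb' : -c t (enIdx d) ≠ 0 := neg_ne_zero.2 hb
  have h1 : HasDerivWithinAt (fun τ => Real.exp (c τ 0 +
      (∑ i, c τ (momIdx i) ^ 2) / (2 * -c τ (enIdx d)) -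
      (γ + Real.log (-c τ (enIdx d))) / (γ - 1)))
      (Real.exp (c t 0 + (∑ i, c t (momIdx i) ^ 2) / (2 * -c t (enIdx d)) -
        (γ + Real.log (-c t (enIdx d))) / (γ - 1)) *
        (c' 0 + ((∑ i, 2 * c t (momIdx i) * c' (momIdx i)) * (2 * -c t (enIdx d)) -
          (∑ i, c t (momIdx i) ^ 2) * (2 * -c' (enIdx d))) / (2 * -c t (enIdx d)) ^ 2 -
          (-c' (enIdx d) / -c t (enIdx d)) / (γ - 1))) s t := by
    refine HasDerivWithinAt.exp ?_
    refine ((hc 0).add ?_).sub ?_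
    · refine HasDerivWithinAt.div ?_ ((hc _).neg.const_mul 2) (mul_ne_zero two_ne_zero hb')
      refine HasDerivWithinAt.fun_sum fun i _ => ?_
      exact ((hc (momIdx i)).fun_pow 2).congr_deriv (by simp)
    · exact (((hc _).neg.log hb').const_add γ).div_const _
  refine (h1.congr (fun τ hτ => density_consVars hγ (hadm τ hτ))
    (density_consVars hγ (hadm t ht))).congr_deriv ?_
  rw [← density_consVars hγ (hadm t ht), dotProduct_state, consVars_en]
  change _ = density (consVars γ (c t)) * _ + _ + _
  have e1 : ∑ i, consVars γ (c t) (momIdx i) * c' (momIdx i) =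
      density (consVars γ (c t)) / (-c t (enIdx d)) * ∑ i, c t (momIdx i) * c' (momIdx i) := by
    rw [Finset.mul_sum]
    refine Finset.sum_congr rfl fun i _ => ?_
    rw [consVars_mom, velocity_consVars]
    field_simp
  have e2 : ∑ i, 2 * c t (momIdx i) * c' (momIdx i) =
      2 * ∑ i, c t (momIdx i) * c' (momIdx i) := by
    rw [Finset.mul_sum]
    exact Finset.sum_congr rfl fun i _ => by ring
  have e3 : (velocity (consVars γ (c t)) ⬝ᵥ velocity (consVars γ (c t))) =
      (∑ i, c t (momIdx i) ^ 2) / c t (enIdx d) ^ 2 := by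
    rw [dotProduct, Finset.sum_div]
    refine Finset.sum_congr rfl fun i _ => ?_
    rw [velocity_consVars]
    field_simp
  rw [e1, e2, e3]
  field_simp
  ring

/-- The fluxes of all components in direction `j` form the gradient of `ρ V_j` with respect to the
entropy variables. -/
theorem hasDerivWithinAt_massFlux {c : ℝ → State d} {c' : State d} {s : Set ℝ} {t : ℝ}
    (hγ : 1 < γ) (hc : ∀ k, HasDerivWithinAt (fun τ => c τ k) (c' k) s t)
    (hadm : ∀ τ ∈ s, Admissible (c τ)) (ht : t ∈ s) (j : Fin d) :
    HasDerivWithinAt (fun τ => density (consVars γ (c τ)) * velocity (consVars γ (c τ)) j)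
      (∑ k, eulerFlux γ (consVars γ (c t)) k j * c' k) s t := by
  have hg : γ - 1 ≠ 0 := by linarith
  have hb : c t (enIdx d) ≠ 0 := ne_of_lt (hadm t ht)
  have h1 := (hasDerivWithinAt_density hγ hc hadm ht).fun_mul
    ((hc (momIdx j)).fun_div (hc (enIdx d)).fun_neg (neg_ne_zero.2 hb))
  refine (h1.congr (fun τ _ => ?_) ?_).congr_deriv ?_
  · simp [velocity_consVars]
  · simp [velocity_consVars]
  rw [sum_state, dotProduct_state]
  simp only [eulerFlux, mkState_zero, mkState_mom, mkState_en, consVars_en, pressure_consVars hγ,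
    add_mul, Finset.sum_add_distrib, ite_mul, zero_mul, Finset.sum_ite_eq', Finset.mem_univ,
    if_true, consVars_mom]
  have e : ∑ i, density (consVars γ (c t)) * velocity (consVars γ (c t)) i *
        velocity (consVars γ (c t)) j * c' (momIdx i) =
      velocity (consVars γ (c t)) j *
        ∑ i, density (consVars γ (c t)) * velocity (consVars γ (c t)) i * c' (momIdx i) := by
    rw [Finset.mul_sum]
    exact Finset.sum_congr rfl fun i _ => by ring
  rw [e, ← velocity_consVars (γ := γ) (c t) j]
  have hd0 : consVars γ (c t) 0 = density (consVars γ (c t)) := rfl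
  have hm : c t (momIdx j) = velocity (consVars γ (c t)) j * -c t (enIdx d) := by
    rw [velocity_consVars]; field_simp
  rw [hd0, hm]
  field_simp
  ring

theorem contDiffAt_density (hγ : 1 < γ) {v : State d} (hv : Admissible v) :
    ContDiffAt ℝ 1 (fun v : State d => density (consVars γ v)) v := by
  have hb : -v (enIdx d) ≠ 0 := neg_ne_zero.2 (ne_of_lt hv)
  have h : ContDiffAt ℝ 1 (fun v : State d => Real.exp (v 0 +
      (∑ i, v (momIdx i) ^ 2) / (2 * -v (enIdx d)) -
      (γ + Real.log (-v (enIdx d))) / (γ - 1))) v := by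
    have hk : ∀ k, ContDiffAt ℝ 1 (fun v : State d => v k) v := fun k => by fun_prop
    refine ContDiffAt.exp (((hk 0).add (ContDiffAt.div ?_ ?_ (mul_ne_zero two_ne_zero hb))).sub
      ((contDiffAt_const.add ((hk _).neg.log hb)).div_const _))
    · fun_prop
    · fun_prop
  refine h.congr_of_eventuallyEq ?_
  filter_upwards [(isOpen_lt (continuous_apply (enIdx d)) continuous_const).mem_nhds hv] with w hw
  exact density_consVars hγ hw

theorem contDiffAt_velocity {v : State d} (hv : Admissible v) (i : Fin d) :
    ContDiffAt ℝ 1 (fun v : State d => velocity (consVars γ v) i) v := by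
  simp only [velocity_consVars]
  exact ContDiffAt.div (by fun_prop) (by fun_prop) (neg_ne_zero.2 (ne_of_lt hv))

theorem contDiffAt_consVars (hγ : 1 < γ) {v : State d} (hv : Admissible v) :
    ContDiffAt ℝ 1 (consVars γ) v := by
  have hd := contDiffAt_density hγ hv
  have hV := contDiffAt_velocity (γ := γ) hv
  refine contDiffAt_pi.2 fun k => ?_
  refine Fin.cases hd (fun l => ?_) k
  refine Fin.lastCases ?_ (fun i => ?_) l
  · rw [Fin.succ_last]
    change ContDiffAt ℝ 1 (fun v => consVars γ v (enIdx d)) v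
    simp only [consVars_en, dotProduct]
    refine ((hd.div (by fun_prop) (neg_ne_zero.2 (ne_of_lt hv))).div_const _).add
      ((hd.mul (ContDiffAt.sum fun i _ => (hV i).mul (hV i))).div_const _)
  · change ContDiffAt ℝ 1 (fun v => consVars γ v (momIdx i)) v
    simp only [consVars_mom]
    exact hd.mul (hV i)

theorem contDiffAt_entropy (hγ : 1 < γ) {v : State d} (hv : Admissible v) :
    ContDiffAt ℝ 1 (fun v : State d => entropy γ (consVars γ v)) v := by
  have h : ContDiffAt ℝ 1 (fun v : State d => v ⬝ᵥ consVars γ v - density (consVars γ v)) v := by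
    have hc := contDiffAt_pi.1 (contDiffAt_consVars hγ hv)
    exact (ContDiffAt.sum fun k _ => (by fun_prop : ContDiffAt ℝ 1 (fun v : State d => v k) v).mul
      (hc k)).sub (contDiffAt_density hγ hv)
  refine h.congr_of_eventuallyEq ?_
  filter_upwards [(isOpen_lt (continuous_apply (enIdx d)) continuous_const).mem_nhds hv] with w hw
  exact entropy_consVars hγ hw

/-- The chain rule `∂H/∂t = v · ∂u/∂t`. -/
theorem hasDerivWithinAt_entropy {c : ℝ → State d} {s : Set ℝ} {t : ℝ}
    (hγ : 1 < γ) (hc : DifferentiableWithinAt ℝ c s t)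
    (hadm : ∀ τ ∈ s, Admissible (c τ)) (ht : t ∈ s) :
    HasDerivWithinAt (fun τ => entropy γ (consVars γ (c τ)))
      (derivWithin (fun τ => consVars γ (c τ)) s t ⬝ᵥ c t) s t := by
  have hc1 := hasDerivWithinAt_pi.1 hc.hasDerivWithinAt
  have hu : DifferentiableWithinAt ℝ (fun τ => consVars γ (c τ)) s t :=
    ((contDiffAt_consVars hγ (hadm t ht)).differentiableAt one_ne_zero).comp_differentiableWithinAt
      t hc
  have hu1 := hasDerivWithinAt_pi.1 hu.hasDerivWithinAt
  -- In the derivative of `H = v · u - ρ` the term `u · v'` cancels against the derivative of `ρ`.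
  have h1 : HasDerivWithinAt (fun τ => c τ ⬝ᵥ consVars γ (c τ))
      (∑ k, (derivWithin c s t k * consVars γ (c t) k +
        c t k * derivWithin (fun τ => consVars γ (c τ)) s t k)) s t :=
    HasDerivWithinAt.fun_sum fun k _ => (hc1 k).mul (hu1 k)
  refine ((h1.sub (hasDerivWithinAt_density hγ hc1 hadm ht)).congr
    (fun τ hτ => entropy_consVars hγ (hadm τ hτ)) (entropy_consVars hγ (hadm t ht))).congr_deriv ?_
  rw [dotProduct, dotProduct, ← Finset.sum_sub_distrib]
  exact Finset.sum_congr rfl fun k _ => by ring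

end Euler

/-! ### The logarithmic mean -/

section LogMean

/-- This division-free form also covers `a = b`. It is the property of the mean on which the entropy
identity of the flux rests. -/
theorem logMean_mul_log {a b : ℝ} (ha : 0 < a) (hb : 0 < b) :
    logMean a b * (Real.log b - Real.log a) = b - a := by
  rw [logMean, ← Real.log_div hb.ne' ha.ne']
  split_ifs with h
  · rw [h, div_self hb.ne', Real.log_one]; simp
  · refine div_mul_cancel₀ _ (Real.log_ne_zero_of_pos_of_ne_one (by positivity) ?_)
    rw [Ne, div_eq_one_iff_eq ha.ne']
    exact fun h' => h h'.symm

theorem logMean_comm {a b : ℝ} : logMean a b = logMean b a := by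
  rw [logMean, logMean]
  by_cases h : a = b
  · simp [h]
  · have hl : Real.log (b / a) = -Real.log (a / b) := by rw [← Real.log_inv, inv_div]
    rw [if_neg h, if_neg (Ne.symm h), hl, ← neg_sub a b, neg_div_neg_eq]

/-- The two bounds are `log x ≤ x - 1` and `1 - 1/x ≤ log x` at `x = b / a`. -/
theorem logMean_mem_Icc_of_le {a b : ℝ} (ha : 0 < a) (h : a ≤ b) : logMean a b ∈ Icc a b := by
  rcases h.eq_or_lt with rfl | h
  · simp [logMean]
  have hb : 0 < b := ha.trans h
  have hl : 0 < Real.log (b / a) := Real.log_pos ((one_lt_div ha).2 h)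
  have h1 : Real.log (b / a) ≤ b / a - 1 := Real.log_le_sub_one_of_pos (by positivity)
  have h2 : 1 - (b / a)⁻¹ ≤ Real.log (b / a) := Real.one_sub_inv_le_log_of_pos (by positivity)
  rw [logMean, if_neg h.ne]
  constructor
  · rw [le_div_iff₀ hl]
    calc a * Real.log (b / a) ≤ a * (b / a - 1) := by gcongr
      _ = b - a := by field_simp
  · rw [div_le_iff₀ hl]
    calc b - a = b * (1 - (b / a)⁻¹) := by field_simp
      _ ≤ b * Real.log (b / a) := by gcongr

theorem logMean_mem_Icc {a b : ℝ} (ha : 0 < a) (hb : 0 < b) :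
    logMean a b ∈ Icc (min a b) (max a b) := by
  rcases le_total a b with h | h
  · rw [min_eq_left h, max_eq_right h]; exact logMean_mem_Icc_of_le ha h
  · rw [min_eq_right h, max_eq_left h, logMean_comm]; exact logMean_mem_Icc_of_le hb h

theorem logMean_pos {a b : ℝ} (ha : 0 < a) (hb : 0 < b) : 0 < logMean a b :=
  (lt_min ha hb).trans_le (logMean_mem_Icc ha hb).1

/-- On the diagonal the mean is squeezed between `min` and `max`; elsewhere the quotient formula
holds in a neighbourhood. -/
theorem continuousAt_logMean {a b : ℝ} (ha : 0 < a) (hb : 0 < b) :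
    ContinuousAt (fun q : ℝ × ℝ => logMean q.1 q.2) (a, b) := by
  by_cases h : a = b
  · subst h
    have hpos : ∀ᶠ q : ℝ × ℝ in nhds (a, a), 0 < q.1 ∧ 0 < q.2 :=
      (continuousAt_fst.eventually (lt_mem_nhds ha)).and
        (continuousAt_snd.eventually (lt_mem_nhds ha))
    have e : logMean a a = a := by simp [logMean]
    have h1 : Filter.Tendsto (fun q : ℝ × ℝ => min q.1 q.2) (nhds (a, a)) (nhds a) := by
      simpa using (continuous_fst.min continuous_snd : Continuous fun q : ℝ × ℝ => _).tendsto (a, a)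
    have h2 : Filter.Tendsto (fun q : ℝ × ℝ => max q.1 q.2) (nhds (a, a)) (nhds a) := by
      simpa using (continuous_fst.max continuous_snd : Continuous fun q : ℝ × ℝ => _).tendsto (a, a)
    rw [ContinuousAt, e]
    exact tendsto_of_tendsto_of_tendsto_of_le_of_le' h1 h2
      (hpos.mono fun q hq => (logMean_mem_Icc hq.1 hq.2).1)
      (hpos.mono fun q hq => (logMean_mem_Icc hq.1 hq.2).2)
  · have hne : ∀ᶠ q : ℝ × ℝ in nhds (a, b), q.1 ≠ q.2 :=
      (isOpen_ne_fun continuous_fst continuous_snd).mem_nhds h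
    have hl : Real.log (b / a) ≠ 0 := by
      refine Real.log_ne_zero_of_pos_of_ne_one (by positivity) ?_
      rw [Ne, div_eq_one_iff_eq ha.ne']
      exact fun h' => h h'.symm
    have : ContinuousAt (fun q : ℝ × ℝ => (q.2 - q.1) / Real.log (q.2 / q.1)) (a, b) := by
      refine ContinuousAt.div (by fun_prop) ?_ hl
      exact (ContinuousAt.div (by fun_prop) (by fun_prop) ha.ne').log (div_pos hb ha).ne'
    refine this.congr (hne.mono fun q hq => ?_)
    simp only [logMean, if_neg hq]

theorem _root_.ContinuousAt.logMean {X : Type*} [TopologicalSpace X] {f g : X → ℝ} {x : X}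
    (hf : ContinuousAt f x) (hg : ContinuousAt g x) (hf0 : 0 < f x) (hg0 : 0 < g x) :
    ContinuousAt (fun x => logMean (f x) (g x)) x :=
  (continuousAt_logMean hf0 hg0).tendsto.comp (hf.prodMk hg).tendsto

end LogMean

/-! ### The entropy-conservative flux -/

section Flux

variable {d : ℕ} {γ : ℝ}

/-- Tadmor's condition: the flux is entropy-conservative. -/
theorem jump_dotProduct_ecFlux (hγ : 1 < γ) {a b : State d} (ha : Admissible a)
    (hb : Admissible b) (n : Fin d → ℝ) :
    (a - b) ⬝ᵥ ecFlux γ a b n -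
      (entropyPotential (consVars γ a) n - entropyPotential (consVars γ b) n) = 0 := by
  have hg : γ - 1 ≠ 0 := by linarith
  have hA := log_density_consVars hγ ha
  have hB := log_density_consVars hγ hb
  have hma : ∀ i, a (momIdx i) = -a (enIdx d) * velocity (consVars γ a) i := fun i => by
    rw [velocity_consVars]; field_simp [ne_of_lt ha]
  have hmb : ∀ i, b (momIdx i) = -b (enIdx d) * velocity (consVars γ b) i := fun i => by
    rw [velocity_consVars]; field_simp [ne_of_lt hb]
  have hρa := density_pos_consVars (γ := γ) a
  have hρb := density_pos_consVars (γ := γ) b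
  have hβa : 0 < -a (enIdx d) := neg_pos.2 ha
  have hβb : 0 < -b (enIdx d) := neg_pos.2 hb
  have hβl := logMean_mul_log hβb hβa
  have hβp := logMean_pos hβb hβa
  have hρl := logMean_mul_log hρb hρa
  simp only [dotProduct_state, ecFlux, ecFluxCons, mkState_zero, mkState_mom, mkState_en,
    Pi.sub_apply, beta_consVars hγ ha, beta_consVars hγ hb, entropyPotential]
  generalize hr : logMean (density (consVars γ b)) (density (consVars γ a)) = r at *
  generalize hq : logMean (-b (enIdx d)) (-a (enIdx d)) = q at *
  set V := velocity (consVars γ b)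
  set W := velocity (consVars γ a)
  set ρa := density (consVars γ a)
  set ρb := density (consVars γ b)
  -- The double negation lets every energy component be expressed through `β` once `-a (enIdx d)` is
  -- generalized.
  have hae : a (enIdx d) = -(-a (enIdx d)) := (neg_neg _).symm
  have hbe : b (enIdx d) = -(-b (enIdx d)) := (neg_neg _).symm
  generalize -a (enIdx d) = βa at *
  generalize -b (enIdx d) = βb at *
  rw [hae, hbe, hA, hB]
  simp only [hma, hmb]
  have hbar : (fun i => mean (V i) (W i)) = (1 / 2 : ℝ) • (V + W) := by
    funext i; simp [mean]; ring
  have e1 : ∀ f p : ℝ, ∑ i, (βa * W i - βb * V i) *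
      (f • (fun i => mean (V i) (W i)) + p • n) i = (βa • W - βb • V) ⬝ᵥ
        (f • ((1 / 2 : ℝ) • (V + W)) + p • n) := fun f p => by
    rw [hbar]; rfl
  rw [e1, hbar]
  simp only [dotProduct_add, add_dotProduct, sub_dotProduct, smul_dotProduct, dotProduct_smul,
    smul_eq_mul, mean]
  rw [dotProduct_comm V W]
  generalize V ⬝ᵥ V = VV
  generalize W ⬝ᵥ W = WW
  generalize W ⬝ᵥ V = VW
  generalize V ⬝ᵥ n = Vn
  generalize W ⬝ᵥ n = Wn
  generalize Real.log ρa = la at *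
  generalize Real.log ρb = lb at *
  -- The logarithmic means turn jumps of logarithms into jumps of `ρ` and `β`. After both
  -- substitutions the claim is a rational identity.
  have hla : la - lb = (ρa - ρb) / r := by
    have : 0 < r := hr ▸ logMean_pos hρb hρa
    rw [← hρl]; field_simp
  have hr0 : r ≠ 0 := (hr ▸ logMean_pos hρb hρa).ne'
  obtain rfl : la = lb + (ρa - ρb) / r := by linarith
  generalize Real.log βa = ka at *
  generalize Real.log βb = kb at *
  have hka : ka - kb = (βa - βb) / q := by rw [← hβl]; field_simp
  obtain rfl : ka = kb + (βa - βb) / q := by linarith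
  have hs : βb + βa ≠ 0 := by positivity
  field_simp
  ring

/-- Needed for integrability of `F̂ · v̂` on the facets, which allows the boundary integrals to be
split. -/
theorem continuousOn_dotProduct_ecFlux (hγ : 1 < γ) (n : Fin d → ℝ) :
    ContinuousOn (fun q : State d × State d => ecFlux γ q.1 q.2 n ⬝ᵥ q.1)
      {q | Admissible q.1 ∧ Admissible q.2} := by
  rintro ⟨a, b⟩ ⟨ha, hb⟩
  simp only at ha hb
  refine ContinuousAt.continuousWithinAt ?_
  have hρa : ContinuousAt (fun q : State d × State d => density (consVars γ q.1)) (a, b) :=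
    (contDiffAt_density hγ ha).continuousAt.tendsto.comp continuousAt_fst
  have hρb : ContinuousAt (fun q : State d × State d => density (consVars γ q.2)) (a, b) :=
    (contDiffAt_density hγ hb).continuousAt.tendsto.comp continuousAt_snd
  have hVa : ∀ i, ContinuousAt (fun q : State d × State d => velocity (consVars γ q.1) i) (a, b) :=
    fun i => (contDiffAt_velocity ha i).continuousAt.tendsto.comp continuousAt_fst
  have hVb : ∀ i, ContinuousAt (fun q : State d × State d => velocity (consVars γ q.2) i) (a, b) :=
    fun i => (contDiffAt_velocity hb i).continuousAt.tendsto.comp continuousAt_snd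
  have hpa : ContinuousAt (fun q : State d × State d => pressure γ (consVars γ q.1)) (a, b) := by
    simp only [pressure_consVars hγ]
    exact hρa.div (by fun_prop) (neg_ne_zero.2 (ne_of_lt ha))
  have hpb : ContinuousAt (fun q : State d × State d => pressure γ (consVars γ q.2)) (a, b) := by
    simp only [pressure_consVars hγ]
    exact hρb.div (by fun_prop) (neg_ne_zero.2 (ne_of_lt hb))
  have hPa := physical_consVars hγ ha
  have hPb := physical_consVars hγ hb
  have hβa : ContinuousAt (fun q : State d × State d => beta γ (consVars γ q.1)) (a, b) :=
    hρa.div hpa hPa.2.ne'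
  have hβb : ContinuousAt (fun q : State d × State d => beta γ (consVars γ q.2)) (a, b) :=
    hρb.div hpb hPb.2.ne'
  have hβap : 0 < beta γ (consVars γ a) := div_pos hPa.1 hPa.2
  have hβbp : 0 < beta γ (consVars γ b) := div_pos hPb.1 hPb.2
  have hr := hρb.logMean hρa hPb.1 hPa.1
  have hq := hβb.logMean hβa hβbp hβap
  have hq0 := (logMean_pos hβbp hβap).ne'
  have hg : γ - 1 ≠ 0 := by linarith
  have hbar : mean (beta γ (consVars γ b)) (beta γ (consVars γ a)) ≠ 0 :=
    (div_pos (add_pos hβbp hβap) two_pos).ne'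
  have hmean : ∀ {f g : State d × State d → ℝ}, ContinuousAt f (a, b) → ContinuousAt g (a, b) →
      ContinuousAt (fun q => mean (f q) (g q)) (a, b) := fun hf hg => (hf.add hg).div_const 2
  have hk : ∀ k, ContinuousAt (fun q : State d × State d => q.1 k) (a, b) := fun k => by fun_prop
  have hdot : ∀ {f g : State d × State d → Fin d → ℝ},
      (∀ i, ContinuousAt (fun q => f q i) (a, b)) → (∀ i, ContinuousAt (fun q => g q i) (a, b)) →
      ContinuousAt (fun q => f q ⬝ᵥ g q) (a, b) := fun hf hg =>
    tendsto_finsetSum _ fun i _ => (hf i).mul (hg i)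
  have hV := fun i => hmean (hVb i) (hVa i)
  have hf1 : ContinuousAt (fun q : State d × State d => ecFlux γ q.1 q.2 n 0) (a, b) := by
    simp only [ecFlux, ecFluxCons, mkState_zero]
    exact hr.mul (hdot hV fun i => continuousAt_const)
  have hf2 : ∀ i, ContinuousAt
      (fun q : State d × State d => ecFlux γ q.1 q.2 n (momIdx i)) (a, b) := fun i => by
    simp only [ecFlux, ecFluxCons, mkState_mom, Pi.add_apply, Pi.smul_apply, smul_eq_mul]
    exact (hf1.mul (hV i)).add
      (((hmean hρb hρa).div (hmean hβb hβa) hbar).mul continuousAt_const)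
  have hf3 : ContinuousAt (fun q : State d × State d => ecFlux γ q.1 q.2 n (enIdx d)) (a, b) := by
    have e : ∀ q : State d × State d, ecFlux γ q.1 q.2 n (enIdx d) =
        (1 / (logMean (beta γ (consVars γ q.2)) (beta γ (consVars γ q.1)) * (γ - 1)) -
          mean (velocity (consVars γ q.2) ⬝ᵥ velocity (consVars γ q.2))
            (velocity (consVars γ q.1) ⬝ᵥ velocity (consVars γ q.1)) / 2) * ecFlux γ q.1 q.2 n 0 +
        (fun i => mean (velocity (consVars γ q.2) i) (velocity (consVars γ q.1) i)) ⬝ᵥ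
          fun i => ecFlux γ q.1 q.2 n (momIdx i) := fun q => by
      simp only [ecFlux, ecFluxCons, mkState_zero, mkState_mom, mkState_en]
    simp only [e]
    exact (((continuousAt_const.div (hq.mul continuousAt_const) (mul_ne_zero hq0 hg)).sub
      ((hmean (hdot hVb hVb) (hdot hVa hVa)).div_const 2)).mul hf1).add (hdot hV hf2)
  simp only [dotProduct_state]
  exact ((hf1.mul (hk 0)).add (tendsto_finsetSum Finset.univ
    fun (i : Fin d) _ => (hf2 i).mul (hk (momIdx i)))).add (hf3.mul (hk (enIdx d)))

end Flux

/-! ### Finite-dimensional spaces of functions -/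

/-- A finite-dimensional space of functions admits Lagrange interpolation. -/
theorem exists_lagrange_basis {X : Type*} (W : Submodule ℝ (X → ℝ)) [FiniteDimensional ℝ W] :
    ∃ (s : Finset X) (φ : s → X → ℝ), (∀ z, φ z ∈ W) ∧
      ∀ f ∈ W, ∀ x, f x = ∑ z : s, f z * φ z x := by
  let ev : X → W →ₗ[ℝ] ℝ := fun x => (LinearMap.proj x).comp W.subtype
  -- The nodes are chosen so that the space of functions vanishing on them is minimal. One more node
  -- cannot shrink it, so these functions vanish everywhere.
  obtain ⟨_, ⟨s, rfl⟩, hmin⟩ := WellFounded.has_min (wellFounded_lt (α := Submodule ℝ W))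
    (range fun s : Finset X => ⨅ x ∈ s, LinearMap.ker (ev x)) (range_nonempty _)
  have hker : ∀ f : W, (∀ x ∈ s, (f : X → ℝ) x = 0) → f = 0 := by
    classical
    intro f hf
    have hfm : f ∈ ⨅ x ∈ s, LinearMap.ker (ev x) := by
      simp only [Submodule.mem_iInf]
      exact fun x hx => hf x hx
    ext x
    have hle : (⨅ y ∈ insert x s, LinearMap.ker (ev y)) ≤ ⨅ y ∈ s, LinearMap.ker (ev y) :=
      biInf_mono fun y hy => Finset.mem_insert_of_mem hy
    have hnl := hmin _ ⟨insert x s, rfl⟩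
    have hge := (hle.eq_or_lt.resolve_right hnl).ge
    have := hge hfm
    simp only [Submodule.mem_iInf] at this
    exact this x (Finset.mem_insert_self x s)
  let R : W →ₗ[ℝ] (s → ℝ) := LinearMap.pi fun z => ev z
  have hR : LinearMap.ker R = ⊥ := by
    rw [LinearMap.ker_eq_bot']
    intro f hf
    exact hker f fun x hx => congrFun hf ⟨x, hx⟩
  obtain ⟨L, hL⟩ := R.exists_leftInverse_of_injective hR
  classical
  refine ⟨s, fun z => (L (Pi.single z 1) : X → ℝ), fun z => (L (Pi.single z 1)).2, ?_⟩
  intro f hf x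
  have h1 : L (R ⟨f, hf⟩) = ⟨f, hf⟩ := LinearMap.congr_fun hL _
  have h2 : R ⟨f, hf⟩ = ∑ z : s, f z • Pi.single z (1 : ℝ) := by
    ext z
    simp [R, ev, Finset.sum_apply, Pi.single_apply]
  rw [h2, map_sum] at h1
  have h3 := congrFun (congrArg Subtype.val h1) x
  -- The basis functions are the images of the unit vectors under a left inverse of restriction to
  -- the nodes.
  simp only [map_smul, Submodule.coe_sum, Submodule.coe_smul, Finset.sum_apply, Pi.smul_apply,
    smul_eq_mul] at h3
  exact h3.symm

section Polynomial

variable {d : ℕ}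

theorem contDiff_eval (q : MvPolynomial (Fin d) ℝ) :
    ContDiff ℝ 1 fun x : Space d => MvPolynomial.eval (fun i => x i) q := by
  induction q using MvPolynomial.induction_on with
  | C a => simpa using contDiff_const
  | add p q hp hq => simpa using hp.add hq
  | mul_X p i hp =>
    simp only [map_mul, MvPolynomial.eval_X]
    exact hp.mul (by fun_prop)

/-- The restrictions to `S` of the polynomials of degree at most `p`. -/
def polySpace (S : Set (Space d)) (p : ℕ) : Submodule ℝ (S → ℝ) :=
  LinearMap.range ((LinearMap.pi fun x : S => (MvPolynomial.aeval (R := ℝ)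
    (fun i => (x : Space d) i)).toLinearMap).comp
      (MvPolynomial.restrictTotalDegree (Fin d) ℝ p).subtype)

instance (S : Set (Space d)) (p : ℕ) : FiniteDimensional ℝ (polySpace S p) := by
  rw [polySpace]
  infer_instance

theorem mem_polySpace {S : Set (Space d)} {p : ℕ} {f : S → ℝ} :
    f ∈ polySpace S p ↔ ∃ q : MvPolynomial (Fin d) ℝ, q.totalDegree ≤ p ∧
      ∀ x : S, f x = MvPolynomial.eval (fun i => (x : Space d) i) q := by
  simp only [polySpace, LinearMap.mem_range, LinearMap.comp_apply, Subtype.exists,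
    MvPolynomial.mem_restrictTotalDegree, Submodule.subtype_apply]
  constructor
  · rintro ⟨q, hq, rfl⟩
    exact ⟨q, hq, fun x => by simp [MvPolynomial.aeval_eq_eval]⟩
  · rintro ⟨q, hq, h⟩
    exact ⟨q, hq, funext fun x => by rw [h]; simp [MvPolynomial.aeval_eq_eval]⟩

/-- If a family of polynomials of bounded degree is differentiable in time at each point of a
compact set, then its increments are uniformly of first order. -/
theorem exists_uniform_increment {S : Set (Space d)} (hS : IsCompact S) {p : ℕ}
    {f : ℝ → Space d → ℝ} {I : Set ℝ} {t₀ : ℝ} (ht₀ : t₀ ∈ I)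
    (hf : ∀ t ∈ I, ∃ q : MvPolynomial (Fin d) ℝ, q.totalDegree ≤ p ∧
      ∀ x ∈ S, f t x = MvPolynomial.eval (fun i => x i) q)
    (hdiff : ∀ x ∈ S, DifferentiableWithinAt ℝ (fun t => f t x) I t₀) :
    ∃ C, ∀ᶠ t in nhdsWithin t₀ I, ∀ x ∈ S, |f t x - f t₀ x| ≤ C * |t - t₀| := by
  -- All time dependence sits in the values at finitely many nodes, so pointwise differentiability
  -- there controls every `x` at once.
  obtain ⟨s, φ, hφ, hint⟩ := exists_lagrange_basis (polySpace S p)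
  have hW : ∀ t ∈ I, (fun x : S => f t x) ∈ polySpace S p := fun t ht => by
    obtain ⟨q, hq, h⟩ := hf t ht
    exact mem_polySpace.2 ⟨q, hq, fun x => h x x.2⟩
  have hbd : ∀ z, ∃ C, 0 ≤ C ∧ ∀ x : S, |φ z x| ≤ C := fun z => by
    obtain ⟨q, _, h⟩ := mem_polySpace.1 (hφ z)
    obtain ⟨C, hC⟩ := hS.exists_bound_of_continuousOn (contDiff_eval q).continuous.continuousOn
    exact ⟨max C 0, le_max_right _ _, fun x => by
      rw [h]; exact (hC x x.2).trans (le_max_left _ _)⟩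
  choose C hC0 hC using hbd
  have hloc : ∀ z : s, ∃ L, ∀ᶠ t in nhdsWithin t₀ I,
      |f t (z : S) - f t₀ (z : S)| ≤ L * |t - t₀| := fun z => by
    obtain ⟨L, hL⟩ := (hdiff _ (z : S).2).isBigO_sub.bound
    exact ⟨L, hL⟩
  choose L hL using hloc
  refine ⟨∑ z, L z * C z, ?_⟩
  filter_upwards [Filter.eventually_all.2 hL, self_mem_nhdsWithin] with t ht htI x hx
  have h1 := hint _ (hW t htI) ⟨x, hx⟩
  have h2 := hint _ (hW t₀ ht₀) ⟨x, hx⟩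
  simp only at h1 h2
  rw [h1, h2, ← Finset.sum_sub_distrib, Finset.sum_mul]
  refine (Finset.abs_sum_le_sum_abs _ _).trans (Finset.sum_le_sum fun z _ => ?_)
  rw [← sub_mul, abs_mul]
  calc _ ≤ (L z * |t - t₀|) * C z :=
        mul_le_mul (ht z) (hC z _) (abs_nonneg _) ((abs_nonneg _).trans (ht z))
    _ = _ := by ring

end Polynomial

/-! ### Compact convex sets of admissible states -/

section Box

variable {d : ℕ} {γ : ℝ}

/-- The states with components bounded by `R` and energy component at most `-δ`. -/
def admissibleBox (d : ℕ) (R δ : ℝ) : Set (State d) :=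
  Metric.closedBall 0 R ∩ {a | a (enIdx d) ≤ -δ}

theorem isCompact_admissibleBox (R δ : ℝ) : IsCompact (admissibleBox d R δ) :=
  (isCompact_closedBall _ _).inter_right (isClosed_le (continuous_apply _) continuous_const)

theorem convex_admissibleBox (R δ : ℝ) : Convex ℝ (admissibleBox d R δ) :=
  (convex_closedBall _ _).inter
    (convex_halfSpace_le (LinearMap.isLinear (LinearMap.proj (R := ℝ) (enIdx d))) _)

theorem admissible_of_mem_box {R δ : ℝ} (hδ : 0 < δ) {a : State d} (ha : a ∈ admissibleBox d R δ) :
    Admissible a :=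
  lt_of_le_of_lt ha.2 (neg_neg_of_pos hδ)

theorem admissibleBox_mono {R R' δ δ' : ℝ} (hR : R ≤ R') (hδ : δ' ≤ δ) :
    admissibleBox d R δ ⊆ admissibleBox d R' δ' := fun _ ha =>
  ⟨Metric.closedBall_subset_closedBall hR ha.1, le_trans ha.2 (neg_le_neg hδ)⟩

theorem exists_box {X : Type*} [TopologicalSpace X] {Q : Set X} (hQ : IsCompact Q)
    {w : X → State d} (hw : ContinuousOn w Q) (hadm : ∀ x ∈ Q, Admissible (w x)) :
    ∃ R δ, 0 < δ ∧ ∀ x ∈ Q, w x ∈ admissibleBox d R δ := by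
  obtain ⟨R, hR⟩ := hQ.exists_bound_of_continuousOn hw
  rcases Q.eq_empty_or_nonempty with rfl | hne
  · exact ⟨0, 1, one_pos, fun x hx => hx.elim⟩
  · have hc : ContinuousOn (fun x => w x (enIdx d)) Q :=
      (continuous_apply (enIdx d)).comp_continuousOn hw
    obtain ⟨x₀, hx₀, hmax⟩ := hQ.exists_isMaxOn hne hc
    refine ⟨R, -w x₀ (enIdx d), neg_pos.2 (hadm x₀ hx₀), fun x hx =>
      ⟨mem_closedBall_zero_iff.2 (hR x hx), ?_⟩⟩
    rw [mem_ofPred_eq, neg_neg]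
    exact hmax hx

/-- The box is compact, which bounds the derivative, and convex, which permits the mean value
inequality. -/
theorem exists_lipschitz_box {Φ : State d → ℝ} (hΦ : ∀ a, Admissible a → ContDiffAt ℝ 1 Φ a)
    {R δ : ℝ} (hδ : 0 < δ) : ∃ L, 0 ≤ L ∧ ∀ a ∈ admissibleBox d R δ, ∀ b ∈ admissibleBox d R δ,
      |Φ a - Φ b| ≤ L * ‖a - b‖ := by
  have hc : ContinuousOn (fderiv ℝ Φ) (admissibleBox d R δ) := fun a ha =>
    (((hΦ a (admissible_of_mem_box hδ ha)).fderiv_right (m := 0)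
      (by simp)).continuousAt).continuousWithinAt
  obtain ⟨C, hC⟩ := (isCompact_admissibleBox R δ).exists_bound_of_continuousOn hc
  refine ⟨max C 0, le_max_right _ _, fun a ha b hb => ?_⟩
  exact (convex_admissibleBox R δ).norm_image_sub_le_of_norm_fderiv_le
    (fun c hc => (hΦ c (admissible_of_mem_box hδ hc)).differentiableAt one_ne_zero)
    (fun c hc => (hC c hc).trans (le_max_left _ _)) hb ha

/-- Extending `Φ` by zero off `C` gives a measurable function that agrees with `Φ` almost everywhere
along `f`; compactness supplies the bound. -/
theorem integrable_comp_of_mem_compact {X Y : Type*} [MeasurableSpace X] {μ : Measure X}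
    [IsFiniteMeasure μ] [TopologicalSpace Y] [T2Space Y] [MeasurableSpace Y] [BorelSpace Y]
    {f : X → Y} (hf : AEMeasurable f μ) {C : Set Y} (hC : IsCompact C)
    (hfC : ∀ᵐ x ∂μ, f x ∈ C) {Φ : Y → ℝ} (hΦ : ContinuousOn Φ C) :
    Integrable (fun x => Φ (f x)) μ := by
  classical
  obtain ⟨B, hB⟩ := hC.exists_bound_of_continuousOn hΦ
  have hm : Measurable (C.piecewise Φ 0) :=
    hΦ.measurable_piecewise continuousOn_const hC.measurableSet
  have hae : (fun x => C.piecewise Φ 0 (f x)) =ᵐ[μ] fun x => Φ (f x) := by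
    filter_upwards [hfC] with x hx
    exact piecewise_eq_of_mem C Φ 0 hx
  refine Integrable.of_bound ((hm.comp_aemeasurable hf).congr hae).aestronglyMeasurable B ?_
  filter_upwards [hfC] with x hx using hB _ hx

end Box

/-! ### The time derivative of the entropy of a macro-element -/

section Time

variable {d : ℕ} [NeZero d] {M : MacroMesh d} {γ : ℝ} {p : ℕ} {T : ℝ}
  {Fhat : State d → State d → (Fin d → ℝ) → State d}
  {v : ℝ → Fin M.N → Space d → State d} {vh : ℝ → Space d → State d}

theorem sub_subset_cell (M : MacroMesh d) (i : Fin M.N) (a : Fin (M.numSub i)) :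
    (M.sub i a).closedInterior ⊆ M.cell i := by
  rw [MacroMesh.cell, ← M.sub_cover i]
  exact subset_iUnion (fun a => (M.sub i a).closedInterior) a

namespace IsHDGSolution

variable (hsol : IsHDGSolution M γ p T Fhat v vh)
include hsol

theorem continuousOn_entropy (hγ : 1 < γ) {t : ℝ} (ht : t ∈ Icc 0 T) (i : Fin M.N) :
    ContinuousOn (fun x => entropy γ (consVars γ (v t i x))) (M.cell i) := fun x hx =>
  (contDiffAt_entropy hγ (hsol.admissible t ht i x hx)).continuousAt.comp_continuousWithinAt
    ((hsol.mem_V t ht i).1 x hx)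

theorem integrableOn_entropy (hγ : 1 < γ) {t : ℝ} (ht : t ∈ Icc 0 T) (i : Fin M.N) :
    IntegrableOn (fun x => entropy γ (consVars γ (v t i x))) (M.cell i) :=
  (hsol.continuousOn_entropy hγ ht i).integrableOn_compact (M.isCompact_cell i)

theorem exists_uniform_increment {t₀ : ℝ} (ht₀ : t₀ ∈ Icc 0 T) (i : Fin M.N) :
    ∃ C, 0 ≤ C ∧ ∀ᶠ t in nhdsWithin t₀ (Icc 0 T), ∀ x ∈ M.cell i,
      ‖v t i x - v t₀ i x‖ ≤ C * |t - t₀| := by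
  have h : ∀ q : Fin (M.numSub i) × Fin (d + 2), ∃ C, ∀ᶠ t in nhdsWithin t₀ (Icc 0 T),
      ∀ x ∈ (M.sub i q.1).closedInterior, |v t i x q.2 - v t₀ i x q.2| ≤ C * |t - t₀| := by
    rintro ⟨a, k⟩
    refine EntropyHDG.exists_uniform_increment (M.sub i a).isCompact_closedInterior (p := p)
      (f := fun t x => v t i x k) ht₀ ?_ ?_
    · intro t ht
      obtain ⟨q, hq, hv⟩ := (hsol.mem_V t ht i).2 a
      exact ⟨q k, hq k, fun x hx => hv x hx k⟩
    · intro x hx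
      exact differentiableWithinAt_pi.1
        (hsol.differentiable i x (sub_subset_cell M i a hx) t₀ ht₀) k
  choose C hC using h
  obtain ⟨B, hB⟩ := Finite.exists_le C
  refine ⟨max B 0, le_max_right _ _, ?_⟩
  filter_upwards [Filter.eventually_all.2 hC] with t ht x hx
  rw [pi_norm_le_iff_of_nonneg (by positivity)]
  intro k
  rw [MacroMesh.cell, ← M.sub_cover i, mem_iUnion] at hx
  obtain ⟨a, ha⟩ := hx
  exact (ht (a, k) x ha).trans (mul_le_mul_of_nonneg_right
    ((hB (a, k)).trans (le_max_left _ _)) (abs_nonneg _))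

/-- Difference quotients of the entropy converge pointwise by the chain rule. They are dominated by
a constant, the Lipschitz constant of the entropy on a box times the uniform increment bound of
`v_h`. -/
theorem hasDerivWithinAt_integral_entropy (hγ : 1 < γ) {t₀ : ℝ} (ht₀ : t₀ ∈ Icc 0 T)
    (i : Fin M.N) :
    HasDerivWithinAt (fun t => ∫ x in M.cell i, entropy γ (consVars γ (v t i x)))
      (∫ x in M.cell i,
        derivWithin (fun τ => consVars γ (v τ i x)) (Icc 0 T) t₀ ⬝ᵥ v t₀ i x) (Icc 0 T) t₀ := by
  have hcell : MeasurableSet (M.cell i) := (M.isCompact_cell i).measurableSet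
  obtain ⟨R, δ, hδ, hbox⟩ := exists_box (M.isCompact_cell i) (hsol.mem_V t₀ ht₀ i).1
    (hsol.admissible t₀ ht₀ i)
  obtain ⟨C, hC0, hC⟩ := hsol.exists_uniform_increment ht₀ i
  -- The box is enlarged by `δ / 2` so that it also contains the states at all times close to `t₀`.
  obtain ⟨L, hL0, hL⟩ := exists_lipschitz_box (Φ := fun a => entropy γ (consVars γ a))
    (fun a ha => contDiffAt_entropy hγ ha) (R := R + δ / 2) (half_pos hδ)
  have hsmall : ∀ᶠ t in nhdsWithin t₀ (Icc 0 T), C * |t - t₀| ≤ δ / 2 := by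
    have hc : Filter.Tendsto (fun t => C * |t - t₀|) (nhdsWithin t₀ (Icc 0 T)) (nhds 0) := by
      have : Continuous fun t => C * |t - t₀| := by fun_prop
      simpa using (this.tendsto t₀).mono_left nhdsWithin_le_nhds
    exact hc.eventually_le_const (half_pos hδ)
  have hbound : ∀ᶠ t in nhdsWithin t₀ (Icc 0 T), ∀ x ∈ M.cell i,
      |entropy γ (consVars γ (v t i x)) - entropy γ (consVars γ (v t₀ i x))| ≤
        L * C * |t - t₀| := by
    filter_upwards [hC, hsmall] with t ht hs x hx
    have hx0 := hbox x hx
    have hd := ht x hx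
    have h1 : v t i x ∈ admissibleBox d (R + δ / 2) (δ / 2) := by
      constructor
      · rw [mem_closedBall_zero_iff]
        have h2 := mem_closedBall_zero_iff.1 hx0.1
        have h3 := norm_add_le (v t i x - v t₀ i x) (v t₀ i x)
        rw [sub_add_cancel] at h3
        linarith
      · have h2 := (norm_le_pi_norm (v t i x - v t₀ i x) (enIdx d)).trans (hd.trans hs)
        rw [Pi.sub_apply, Real.norm_eq_abs] at h2
        have h3 : v t₀ i x (enIdx d) ≤ -δ := hx0.2
        have h4 := (abs_le.1 h2).2
        change v t i x (enIdx d) ≤ -(δ / 2)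
        linarith
    have h2 : v t₀ i x ∈ admissibleBox d (R + δ / 2) (δ / 2) :=
      admissibleBox_mono (by linarith) (by linarith) hx0
    calc _ ≤ L * ‖v t i x - v t₀ i x‖ := hL _ h1 _ h2
      _ ≤ L * (C * |t - t₀|) := mul_le_mul_of_nonneg_left hd hL0
      _ = _ := by ring
  -- Slopes relative to `[0, T]` treat the endpoints together with the interior times.
  rw [hasDerivWithinAt_iff_tendsto_slope]
  have hle : nhdsWithin t₀ (Icc 0 T \ {t₀}) ≤ nhdsWithin t₀ (Icc 0 T) :=
    nhdsWithin_mono _ sdiff_subset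
  have hlim := tendsto_integral_filter_of_dominated_convergence
    (μ := volume.restrict (M.cell i)) (l := nhdsWithin t₀ (Icc 0 T \ {t₀}))
    (F := fun t x => slope (fun τ => entropy γ (consVars γ (v τ i x))) t₀ t)
    (f := fun x => derivWithin (fun τ => consVars γ (v τ i x)) (Icc 0 T) t₀ ⬝ᵥ v t₀ i x)
    (fun _ => L * C) ?_ ?_ ?_ ?_
  · refine hlim.congr' ?_
    filter_upwards [hle self_mem_nhdsWithin] with t ht
    simp only [slope_def_field]
    rw [integral_div, integral_sub (hsol.integrableOn_entropy hγ ht i)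
      (hsol.integrableOn_entropy hγ ht₀ i)]
  · filter_upwards [hle self_mem_nhdsWithin] with t ht
    simp only [slope_def_field]
    exact (((hsol.integrableOn_entropy hγ ht i).sub
      (hsol.integrableOn_entropy hγ ht₀ i)).div_const _).aestronglyMeasurable
  · filter_upwards [hle hbound, self_mem_nhdsWithin] with t ht htI
    filter_upwards [ae_restrict_mem hcell] with x hx
    have hne : 0 < |t - t₀| := abs_pos.2 (sub_ne_zero.2 htI.2)
    rw [slope_def_field, Real.norm_eq_abs, abs_div, div_le_iff₀ hne]
    exact ht x hx
  · exact integrable_const_iff.2 (Or.inr ⟨by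
      rw [Measure.restrict_apply_univ]; exact (M.isCompact_cell i).measure_lt_top⟩)
  · filter_upwards [ae_restrict_mem hcell] with x hx
    exact hasDerivWithinAt_iff_tendsto_slope.1 (hasDerivWithinAt_entropy hγ
      (hsol.differentiable i x hx t₀ ht₀) (fun τ hτ => hsol.admissible τ hτ i x hx) ht₀)

end IsHDGSolution

end Time

/-! ### Traces on the boundary of a macro-element -/

namespace MacroMesh

variable {d : ℕ} [NeZero d] (M : MacroMesh d)

theorem facet_subset_frontier (j : Fin M.N) (l : Fin (d + 1)) :
    M.facet j l ⊆ frontier (M.cell j) := by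
  rw [cell, frontier_closedInterior]
  exact subset_iUnion (fun k => ((M.elem j).faceOpposite k).closedInterior) l

theorem isCompact_interface (i j : Fin M.N) (m : Fin d → ℤ) : IsCompact (M.interface i j m) :=
  (M.isCompact_cell i).of_isClosed_subset (isClosed_frontier.inter isClosed_frontier)
    fun _ hx => (M.isCompact_cell i).isClosed.frontier_subset hx.1

theorem finite_isFace (i : Fin M.N) :
    Finite {q : Fin M.N × (Fin d → ℤ) // M.IsFace i q.1 q.2} := by
  refine ((M.finite_cellShift_inter (M.isCompact_cell i).isBounded).subset ?_).to_subtype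
  intro q hq
  obtain ⟨x, hx⟩ := nonempty_of_measure_ne_zero hq.2
  exact ⟨x, (M.isClosed_cellShift q).frontier_subset hx.2,
    (M.isCompact_cell i).isClosed.frontier_subset hx.1⟩

/-- The facets of a macro-element are covered by its faces up to a null set. -/
theorem facetMeasure_le (j : Fin M.N) (l : Fin (d + 1)) :
    M.facetMeasure j l ≤ (Measure.euclideanHausdorffMeasure (d - 1)).restrict
      (⋃ q : {q : Fin M.N × (Fin d → ℤ) // M.IsFace j q.1 q.2}, M.interface j q.1.1 q.1.2) := by
  refine Measure.restrict_mono_ae ?_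
  -- Interfaces that are not faces are null, and there are countably many of them. Almost every
  -- point of the facet must therefore lie on a genuine face.
  have h : ∀ᵐ x ∂(Measure.euclideanHausdorffMeasure (d - 1) : Measure (Space d)),
      ∀ q : Fin M.N × (Fin d → ℤ), q ≠ (j, 0) → ¬ M.IsFace j q.1 q.2 →
        x ∉ M.interface j q.1 q.2 := by
    rw [ae_all_iff]
    intro q
    by_cases hq : q ≠ (j, 0) ∧ ¬ M.IsFace j q.1 q.2
    · have h0 : Measure.euclideanHausdorffMeasure (d - 1) (M.interface j q.1 q.2) = 0 := by
        by_contra hne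
        exact hq.2 ⟨hq.1, hne⟩
      filter_upwards [measure_eq_zero_iff_ae_notMem.1 h0] with x hx _ _ using hx
    · exact Filter.Eventually.of_forall fun x h1 h2 => (hq ⟨h1, h2⟩).elim
  filter_upwards [h] with x hx hxf
  obtain ⟨j', m, hne, hmem⟩ := M.exists_mem_interface (M.facet_subset_frontier j l hxf)
  by_contra hn
  refine hx (j', m) hne (fun hf => hn ?_) hmem
  exact mem_iUnion.2 ⟨⟨(j', m), hf⟩, hmem⟩

end MacroMesh

section Trace

variable {d : ℕ} [NeZero d] {M : MacroMesh d} {p : ℕ}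

theorem continuous_evalState (q : Fin (d + 2) → MvPolynomial (Fin d) ℝ) :
    Continuous fun (x : Space d) k => MvPolynomial.eval (fun i => x i) (q k) :=
  continuous_pi fun k => (contDiff_eval (q k)).continuous

/-- On each face the trace is almost everywhere a polynomial, and the faces cover the facet up to a
null set. -/
theorem InTrace.aemeasurable {μ : Space d → State d} (hμ : InTrace M p μ) (j : Fin M.N)
    (l : Fin (d + 1)) : AEMeasurable μ (M.facetMeasure j l) := by
  refine AEMeasurable.mono_measure ?_ (M.facetMeasure_le j l)
  rw [aemeasurable_iUnion_iff]
  intro q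
  obtain ⟨r, _, hr⟩ := hμ.2 j _ _ q.2
  refine (continuous_evalState r).measurable.aemeasurable.congr ?_
  filter_upwards [hr] with x hx
  exact funext fun k => (hx k).symm

/-- A cell has finitely many faces. On each of them the polynomial is bounded and the energy
component stays away from zero, so the values lie in a finite union of boxes. -/
theorem exists_compact_trace {μ : Space d → State d} (hμ : InTrace M p μ)
    (hadm : AdmissibleTrace M μ) (j : Fin M.N) :
    ∃ C : Set (State d), IsCompact C ∧ (∀ a ∈ C, Admissible a) ∧
      ∀ l, ∀ᵐ x ∂M.facetMeasure j l, μ x ∈ C := by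
  have h : ∀ q : {q : Fin M.N × (Fin d → ℤ) // M.IsFace j q.1 q.2}, ∃ R δ, 0 < δ ∧
      ∀ᵐ x ∂(Measure.euclideanHausdorffMeasure (d - 1)).restrict (M.interface j q.1.1 q.1.2),
        μ x ∈ admissibleBox d R δ := by
    intro q
    obtain ⟨r, _, hr⟩ := hμ.2 j _ _ q.2
    obtain ⟨δ, hδ, hle⟩ := hadm j _ _ q.2
    have hcomp := M.isCompact_interface j q.1.1 q.1.2
    obtain ⟨R, hR⟩ := hcomp.exists_bound_of_continuousOn (continuous_evalState r).continuousOn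
    refine ⟨R, δ, hδ, ?_⟩
    filter_upwards [hr, hle, ae_restrict_mem hcomp.measurableSet] with x h1 h2 h3
    refine ⟨?_, h2⟩
    rw [mem_closedBall_zero_iff, show μ x = _ from funext h1]
    exact hR x h3
  choose R δ hδ hbox using h
  have := M.finite_isFace j
  refine ⟨⋃ q, admissibleBox d (R q) (δ q),
    isCompact_iUnion fun q => isCompact_admissibleBox _ _, fun a ha => ?_, fun l => ?_⟩
  · obtain ⟨q, hq⟩ := mem_iUnion.1 ha
    exact admissible_of_mem_box (hδ q) hq
  · refine ae_mono (M.facetMeasure_le j l) ((ae_restrict_iUnion_iff _ _).2 fun q => ?_)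
    filter_upwards [hbox q] with x hx
    exact mem_iUnion.2 ⟨q, hx⟩

end Trace

/-! ### The entropy balance of the scheme -/

section Balance

variable {d : ℕ} [NeZero d] {M : MacroMesh d} {γ : ℝ} {p : ℕ} {T : ℝ}
  {Fhat : State d → State d → (Fin d → ℝ) → State d}
  {v : ℝ → Fin M.N → Space d → State d} {vh : ℝ → Space d → State d}

theorem contDiffAt_massFlux (hγ : 1 < γ) {a : State d} (ha : Admissible a) (j : Fin d) :
    ContDiffAt ℝ 1 (fun a : State d => density (consVars γ a) * velocity (consVars γ a) j) a :=
  (contDiffAt_density hγ ha).mul (contDiffAt_velocity ha j)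

theorem entropyPotential_eq_sum (u : State d) (n : Fin d → ℝ) :
    entropyPotential u n = ∑ j, n j * (density u * velocity u j) := by
  simp only [entropyPotential, dotProduct, Finset.mul_sum]
  exact Finset.sum_congr rfl fun j _ => by ring

theorem continuousOn_entropyPotential (hγ : 1 < γ) (n : Fin d → ℝ) :
    ContinuousOn (fun a : State d => entropyPotential (consVars γ a) n) {a | Admissible a} := by
  simp only [entropyPotential_eq_sum]
  exact continuousOn_finsetSum _ fun j _ => continuousOn_const.mul fun a ha =>
    (contDiffAt_massFlux hγ ha j).continuousAt.continuousWithinAt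

namespace IsHDGSolution

/-- This makes the divergence theorem applicable to `ρ V_j`. The extension of a piece is obtained by
inserting the polynomial of the finite element, which is admissible on the closed element. -/
theorem piecewiseC1_massFlux (hsol : IsHDGSolution M γ p T Fhat v vh) (hγ : 1 < γ) {t : ℝ}
    (ht : t ∈ Icc 0 T) (i : Fin M.N) (j : Fin d) :
    PiecewiseC1 (M.elem i) (M.sub i)
      fun x => density (consVars γ (v t i x)) * velocity (consVars γ (v t i x)) j where
  cover := M.sub_cover i
  continuousOn := fun x hx =>
    (contDiffAt_massFlux hγ (hsol.admissible t ht i x hx) j).continuousAt.comp_continuousWithinAt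
      ((hsol.mem_V t ht i).1 x hx)
  piece a := by
    obtain ⟨q, _, hq⟩ := (hsol.mem_V t ht i).2 a
    have heq : ∀ x ∈ (M.sub i a).closedInterior,
        v t i x = fun k => MvPolynomial.eval (fun i => x i) (q k) := fun x hx => funext (hq x hx)
    refine ⟨fun x => density (consVars γ fun k => MvPolynomial.eval (fun i => x i) (q k)) *
      velocity (consVars γ fun k => MvPolynomial.eval (fun i => x i) (q k)) j, fun x hx => ?_,
      fun x hx => by simp only [heq x hx]⟩
    have hadm := hsol.admissible t ht i x (sub_subset_cell M i a hx)
    rw [heq x hx] at hadm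
    have hp : ContDiff ℝ 1 fun (x : Space d) k => MvPolynomial.eval (fun i => x i) (q k) :=
      contDiff_pi.2 fun k => contDiff_eval (q k)
    exact (contDiffAt_massFlux hγ hadm j).comp x hp.contDiffAt

/-- Near a point off the facets `v_h` is a single polynomial. Restriction to the line through `x` in
direction `w` reduces the claim to the one-variable chain rule `hasDerivWithinAt_massFlux`. -/
theorem fderiv_massFlux (hsol : IsHDGSolution M γ p T Fhat v vh) (hγ : 1 < γ) {t : ℝ}
    (ht : t ∈ Icc 0 T) (i : Fin M.N) (j : Fin d) {x : Space d} (hx : x ∈ M.cell i)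
    (hoff : OffFacets (M.sub i) x) (w : Space d) :
    fderiv ℝ (fun x => density (consVars γ (v t i x)) * velocity (consVars γ (v t i x)) j) x w =
      ∑ k, eulerFlux γ (consVars γ (v t i x)) k j * fderiv ℝ (fun y => v t i y k) x w := by
  obtain ⟨a, ha⟩ := hoff.exists_mem_interior (M.sub_cover i) hx
  obtain ⟨q, _, hq⟩ := (hsol.mem_V t ht i).2 a
  have hv : ∀ k, DifferentiableAt ℝ (fun y => v t i y k) x := fun k =>
    ((contDiff_eval (q k)).differentiable one_ne_zero x).congr_of_eventuallyEq
      (Filter.eventuallyEq_of_mem (mem_interior_iff_mem_nhds.1 ha) fun y hy => hq y hy k)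
  have hg := (hsol.piecewiseC1_massFlux hγ ht i j).differentiableAt hoff hx
  set s : Set ℝ := {τ | x + τ • w ∈ interior (M.sub i a).closedInterior} with hs
  have hs0 : s ∈ nhds (0 : ℝ) :=
    (isOpen_interior.preimage (by fun_prop : Continuous fun τ : ℝ => x + τ • w)).mem_nhds
      (by simpa using ha)
  have hline : HasDerivAt (fun τ : ℝ => x + τ • w) w 0 := by
    simpa using ((hasDerivAt_id (0 : ℝ)).smul_const w).const_add x
  have hchain : ∀ {f : Space d → ℝ}, DifferentiableAt ℝ f x →
      HasDerivAt (fun τ : ℝ => f (x + τ • w)) (fderiv ℝ f x w) 0 := fun {f} hf => by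
    have hf' : HasFDerivAt f (fderiv ℝ f x) (x + (0 : ℝ) • w) := by simpa using hf.hasFDerivAt
    exact hf'.comp_hasDerivAt (0 : ℝ) hline
  have h1 := hasDerivWithinAt_massFlux (c := fun τ => v t i (x + τ • w)) (s := s) hγ
    (fun k => (hchain (hv k)).hasDerivWithinAt)
    (fun τ hτ => hsol.admissible t ht i _ (sub_subset_cell M i a (interior_subset hτ)))
    (mem_of_mem_nhds hs0) j
  have h2 := (h1.hasDerivAt hs0).unique (hchain hg)
  simp only [zero_smul, add_zero] at h2
  exact h2.symm

theorem aemeasurable_facet (hsol : IsHDGSolution M γ p T Fhat v vh) {t : ℝ}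
    (ht : t ∈ Icc 0 T) (i : Fin M.N) (l : Fin (d + 1)) :
    AEMeasurable (v t i) (M.facetMeasure i l) :=
  ((hsol.mem_V t ht i).1.mono (M.facet_subset_cell i l)).aemeasurable (M.measurableSet_facet i l)

theorem exists_compact_facet (hsol : IsHDGSolution M γ p T Fhat v vh) {t : ℝ}
    (ht : t ∈ Icc 0 T) (i : Fin M.N) :
    ∃ C : Set (State d), IsCompact C ∧ (∀ a ∈ C, Admissible a) ∧
      ∀ l, ∀ᵐ x ∂M.facetMeasure i l, v t i x ∈ C := by
  obtain ⟨R, δ, hδ, hbox⟩ := exists_box (M.isCompact_cell i) (hsol.mem_V t ht i).1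
    (hsol.admissible t ht i)
  refine ⟨_, isCompact_admissibleBox R δ, fun a ha => admissible_of_mem_box hδ ha, fun l => ?_⟩
  filter_upwards [ae_restrict_mem (M.measurableSet_facet i l)] with x hx
  exact hbox x (M.facet_subset_cell i l hx)

theorem integrable_comp_facet (hsol : IsHDGSolution M γ p T Fhat v vh) {t : ℝ}
    (ht : t ∈ Icc 0 T) {Φ : State d → ℝ} (hΦ : ContinuousOn Φ {a | Admissible a}) (i : Fin M.N)
    (l : Fin (d + 1)) : Integrable (fun x => Φ (v t i x)) (M.facetMeasure i l) := by
  obtain ⟨C, hC, hadm, hmem⟩ := hsol.exists_compact_facet ht i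
  exact integrable_comp_of_mem_compact (hsol.aemeasurable_facet ht i l) hC (hmem l) (hΦ.mono hadm)

theorem integrable_comp_trace (hsol : IsHDGSolution M γ p T Fhat v vh) {t : ℝ}
    (ht : t ∈ Icc 0 T) {Φ : State d → ℝ} (hΦ : ContinuousOn Φ {a | Admissible a}) (i : Fin M.N)
    (l : Fin (d + 1)) : Integrable (fun x => Φ (vh t x)) (M.facetMeasure i l) := by
  obtain ⟨C, hC, hadm, hmem⟩ :=
    exists_compact_trace (hsol.mem_trace t ht) (hsol.admissible_trace t ht) i
  exact integrable_comp_of_mem_compact ((hsol.mem_trace t ht).aemeasurable i l) hC (hmem l)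
    (hΦ.mono hadm)

theorem integrable_comp_pair (hsol : IsHDGSolution M γ p T Fhat v vh) {t : ℝ}
    (ht : t ∈ Icc 0 T) {Φ : State d × State d → ℝ}
    (hΦ : ContinuousOn Φ {q | Admissible q.1 ∧ Admissible q.2}) (i : Fin M.N)
    (l : Fin (d + 1)) : Integrable (fun x => Φ (vh t x, v t i x)) (M.facetMeasure i l) := by
  obtain ⟨C, hC, hadm, hmem⟩ := hsol.exists_compact_facet ht i
  obtain ⟨C', hC', hadm', hmem'⟩ :=
    exists_compact_trace (hsol.mem_trace t ht) (hsol.admissible_trace t ht) i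
  refine integrable_comp_of_mem_compact (f := fun x => (vh t x, v t i x))
    (((hsol.mem_trace t ht).aemeasurable i l).prodMk (hsol.aemeasurable_facet ht i l))
    (hC'.prod hC) ?_ (hΦ.mono fun q hq => ⟨hadm' _ hq.1, hadm _ hq.2⟩)
  filter_upwards [hmem l, hmem' l] with x h1 h2 using ⟨h2, h1⟩

/-- The volume term tested with the entropy variables is a boundary integral of the entropy
potential. -/
theorem integral_flux_fderiv (hsol : IsHDGSolution M γ p T Fhat v vh) (hγ : 1 < γ) {t : ℝ}
    (ht : t ∈ Icc 0 T) (i : Fin M.N) :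
    ∫ x in M.cell i, ∑ k, ∑ j, eulerFlux γ (consVars γ (v t i x)) k j *
        fderiv ℝ (fun y => v t i y k) x (EuclideanSpace.single j 1) =
      ∑ l, ∫ x, entropyPotential (consVars γ (v t i x)) (fun j => outwardNormal (M.elem i) l j)
        ∂M.facetMeasure i l := by
  have hpc := hsol.piecewiseC1_massFlux hγ ht i
  have h1 : ∫ x in M.cell i, ∑ k, ∑ j, eulerFlux γ (consVars γ (v t i x)) k j *
        fderiv ℝ (fun y => v t i y k) x (EuclideanSpace.single j 1) =
      ∫ x in M.cell i, ∑ j, fderiv ℝ (fun x => density (consVars γ (v t i x)) *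
        velocity (consVars γ (v t i x)) j) x (EuclideanSpace.single j 1) := by
    refine integral_congr_ae ?_
    filter_upwards [ae_restrict_of_ae (ae_offFacets (M.sub i)),
      ae_restrict_mem (M.isCompact_cell i).measurableSet] with x hoff hx
    rw [Finset.sum_comm]
    exact Finset.sum_congr rfl fun j _ => (hsol.fderiv_massFlux hγ ht i j hx hoff _).symm
  rw [h1, MacroMesh.cell, integral_finsetSum Finset.univ fun j _ =>
    (hpc j).integrableOn_fderiv (EuclideanSpace.single j 1), ← MacroMesh.cell]
  have h2 : ∀ j, ∫ x in M.cell i, fderiv ℝ (fun x => density (consVars γ (v t i x)) *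
        velocity (consVars γ (v t i x)) j) x (EuclideanSpace.single j 1) =
      ∑ l, ∫ x, outwardNormal (M.elem i) l j * (density (consVars γ (v t i x)) *
        velocity (consVars γ (v t i x)) j) ∂M.facetMeasure i l := fun j => by
    refine ((hpc j).integral_fderiv _).trans (Finset.sum_congr rfl fun l _ => ?_)
    rw [integral_const_mul, EuclideanSpace.inner_single_right]
    simp [MacroMesh.facetMeasure, MacroMesh.facet]
  rw [Finset.sum_congr rfl fun j _ => h2 j, Finset.sum_comm]
  refine Finset.sum_congr rfl fun l _ => ?_
  simp only [entropyPotential_eq_sum]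
  rw [integral_finsetSum _ fun j _ => ?_]
  refine Integrable.const_mul ?_ _
  exact hsol.integrable_comp_facet ht (fun a ha =>
    (contDiffAt_massFlux hγ ha j).continuousAt.continuousWithinAt) i l

/-- The potential is linear in the normal, with coefficients `ρ V_j` that are single-valued and
periodic on the skeleton. The normals therefore cancel for each `j` separately. -/
theorem sum_integral_entropyPotential_trace (hsol : IsHDGSolution M γ p T Fhat v vh) (hγ : 1 < γ)
    {t : ℝ} (ht : t ∈ Icc 0 T) :
    ∑ i, ∑ l, ∫ x, entropyPotential (consVars γ (vh t x))
      (fun j => outwardNormal (M.elem i) l j) ∂M.facetMeasure i l = 0 := by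
  have hint : ∀ i l j, Integrable (fun x => density (consVars γ (vh t x)) *
      velocity (consVars γ (vh t x)) j) (M.facetMeasure i l) := fun i l j =>
    hsol.integrable_comp_trace ht (fun a ha =>
      (contDiffAt_massFlux hγ ha j).continuousAt.continuousWithinAt) i l
  have h : ∀ i l, ∫ x, entropyPotential (consVars γ (vh t x))
      (fun j => outwardNormal (M.elem i) l j) ∂M.facetMeasure i l =
      ∑ j, inner ℝ (outwardNormal (M.elem i) l) (EuclideanSpace.single j (1 : ℝ)) *
        ∫ x, density (consVars γ (vh t x)) * velocity (consVars γ (vh t x)) j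
          ∂M.facetMeasure i l := fun i l => by
    simp only [entropyPotential_eq_sum]
    rw [integral_finsetSum _ fun j _ => (hint i l j).const_mul _]
    refine Finset.sum_congr rfl fun j _ => ?_
    rw [integral_const_mul, EuclideanSpace.inner_single_right]
    simp
  simp only [h]
  have h0 := fun j : Fin d =>
    M.sum_inner_normal_mul_integral_eq_zero (EuclideanSpace.single j (1 : ℝ))
      (G := fun x => density (consVars γ (vh t x)) * velocity (consVars γ (vh t x)) j)
      (fun x m => by simp only [(hsol.mem_trace t ht).1 x m]) fun i l => hint i l j
  calc _ = ∑ j : Fin d, ∑ i, ∑ l, inner ℝ (outwardNormal (M.elem i) l)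
        (EuclideanSpace.single j (1 : ℝ)) * ∫ x, density (consVars γ (vh t x)) *
          velocity (consVars γ (vh t x)) j ∂M.facetMeasure i l := by
        symm
        rw [Finset.sum_comm]
        exact Finset.sum_congr rfl fun i _ => Finset.sum_comm
    _ = 0 := Finset.sum_eq_zero fun j _ => h0 j

/-- The boundary term tested with the entropy variables equals the volume term. -/
theorem sum_boundaryIntegral_eq (hsol : IsHDGSolution M γ p T (ecFlux γ) v vh) (hγ : 1 < γ)
    {t : ℝ} (ht : t ∈ Icc 0 T) :
    (∑ i, boundaryIntegral (M.elem i) fun x n => ecFlux γ (vh t x) (v t i x) n ⬝ᵥ v t i x) =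
      ∑ i, ∑ l, ∫ x, entropyPotential (consVars γ (v t i x))
        (fun j => outwardNormal (M.elem i) l j) ∂M.facetMeasure i l := by
  -- The trace itself is an admissible test function.
  have htr := hsol.trace_eq t ht _ (hsol.mem_trace t ht)
  have hps := hsol.sum_integral_entropyPotential_trace hγ ht
  -- Tadmor's identity integrated over a facet. Summed over all facets, the first two integrals on
  -- the right vanish by `htr` and `hps`.
  have key : ∀ i l, ∫ x, ecFlux γ (vh t x) (v t i x) (fun j => outwardNormal (M.elem i) l j) ⬝ᵥ
        v t i x ∂M.facetMeasure i l =
      ∫ x, ecFlux γ (vh t x) (v t i x) (fun j => outwardNormal (M.elem i) l j) ⬝ᵥ vh t x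
        ∂M.facetMeasure i l -
      ∫ x, entropyPotential (consVars γ (vh t x)) (fun j => outwardNormal (M.elem i) l j)
        ∂M.facetMeasure i l +
      ∫ x, entropyPotential (consVars γ (v t i x)) (fun j => outwardNormal (M.elem i) l j)
        ∂M.facetMeasure i l := fun i l => by
    set n : Fin d → ℝ := fun j => outwardNormal (M.elem i) l j
    have h1 : Integrable (fun x => ecFlux γ (vh t x) (v t i x) n ⬝ᵥ vh t x)
        (M.facetMeasure i l) :=
      hsol.integrable_comp_pair ht (continuousOn_dotProduct_ecFlux hγ n) i l
    have h2 := hsol.integrable_comp_trace ht (continuousOn_entropyPotential hγ n) i l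
    have h3 := hsol.integrable_comp_facet ht (continuousOn_entropyPotential hγ n) i l
    rw [← integral_sub h1 h2, ← integral_add ((h1.sub h2 :) : Integrable (fun x => _ - _) _) h3]
    refine integral_congr_ae ?_
    obtain ⟨C, _, hadm, hmem⟩ := hsol.exists_compact_facet ht i
    obtain ⟨C', _, hadm', hmem'⟩ :=
      exists_compact_trace (hsol.mem_trace t ht) (hsol.admissible_trace t ht) i
    filter_upwards [hmem l, hmem' l] with x hx hx'
    have hj := jump_dotProduct_ecFlux hγ (hadm' _ hx') (hadm _ hx) n
    rw [sub_dotProduct, dotProduct_comm (vh t x), dotProduct_comm (v t i x)] at hj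
    linarith
  change ∑ i, ∑ l, ∫ x, ecFlux γ (vh t x) (v t i x) (fun j => outwardNormal (M.elem i) l j) ⬝ᵥ
    v t i x ∂M.facetMeasure i l = _
  change ∑ i, ∑ l, ∫ x, ecFlux γ (vh t x) (v t i x) (fun j => outwardNormal (M.elem i) l j) ⬝ᵥ
    vh t x ∂M.facetMeasure i l = 0 at htr
  simp only [key, Finset.sum_add_distrib, Finset.sum_sub_distrib, htr, hps, sub_zero, zero_add]

theorem hasDerivWithinAt_totalEntropy (hsol : IsHDGSolution M γ p T (ecFlux γ) v vh)
    (hγ : 1 < γ) {t : ℝ} (ht : t ∈ Icc 0 T) :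
    HasDerivWithinAt (totalEntropy M γ v) 0 (Icc 0 T) t := by
  have h := HasDerivWithinAt.fun_sum (u := Finset.univ) fun i _ =>
    hsol.hasDerivWithinAt_integral_entropy hγ ht i
  refine h.congr_deriv ?_
  -- With `w = v_h` the boundary and volume terms cancel, which leaves the time derivative of the
  -- entropy.
  have hc := hsol.cell_eq t ht _ (hsol.mem_V t ht)
  rw [hsol.sum_boundaryIntegral_eq hγ ht,
    Finset.sum_congr rfl fun i _ => hsol.integral_flux_fderiv hγ ht i, sub_add_cancel] at hc
  exact hc

end IsHDGSolution

end Balance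

end EntropyHDG

end

/-! ### Entropy conservation of the scheme -/

theorem theorem2 (d : ℕ) [NeZero d] (M : EntropyHDG.MacroMesh d) (γ : ℝ) (hγ : 1 < γ)
    (p : ℕ) (T : ℝ) (hT : 0 < T)
    (v : ℝ → Fin M.N → EntropyHDG.Space d → EntropyHDG.State d)
    (vh : ℝ → EntropyHDG.Space d → EntropyHDG.State d)
    (hsol : EntropyHDG.IsHDGSolution M γ p T (EntropyHDG.ecFlux γ) v vh) :
    -- the flux is entropy-conservative: `[[v]]ᵀ F̂ - [[Ψ_n]] = 0` for all admissible states
    (∀ a b : EntropyHDG.State d, EntropyHDG.Admissible a → EntropyHDG.Admissible b →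
      ∀ n : Fin d → ℝ, (a - b) ⬝ᵥ EntropyHDG.ecFlux γ a b n -
        (EntropyHDG.entropyPotential (EntropyHDG.consVars γ a) n -
          EntropyHDG.entropyPotential (EntropyHDG.consVars γ b) n) = 0) ∧
    -- the total generalized entropy is a well-defined integral and is conserved in time
    (∀ t ∈ Set.Icc 0 T, ∀ i, MeasureTheory.IntegrableOn
      (fun x => EntropyHDG.entropy γ (EntropyHDG.consVars γ (v t i x))) (M.cell i)) ∧
    (∀ t ∈ Set.Icc 0 T,
      HasDerivWithinAt (EntropyHDG.totalEntropy M γ v) 0 (Set.Icc 0 T) t) ∧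
    (∀ t ∈ Set.Icc 0 T,
      EntropyHDG.totalEntropy M γ v t = EntropyHDG.totalEntropy M γ v 0) := by
  have hderiv : ∀ t ∈ Set.Icc 0 T,
      HasDerivWithinAt (EntropyHDG.totalEntropy M γ v) 0 (Set.Icc 0 T) t :=
    fun t ht => hsol.hasDerivWithinAt_totalEntropy hγ ht
  refine ⟨fun a b ha hb n => EntropyHDG.jump_dotProduct_ecFlux hγ ha hb n,
    fun t ht i => hsol.integrableOn_entropy hγ ht i, hderiv, ?_⟩
  -- At `t < T` the interval `[0, T]` is a right neighbourhood of `t`, so the derivative within it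
  -- yields the right derivative.
  exact constant_of_has_deriv_right_zero (fun t ht => (hderiv t ht).continuousWithinAt)
    fun t ht => ((hderiv t (Set.Ico_subset_Icc_self ht)).mono_of_mem_nhdsWithin
      (Icc_mem_nhdsGE_of_mem ht))
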